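/- Let $c_0>0$, $a>0$, $\alpha>0$, let $\tilde L(p)=a\,p^{\alpha}$ (principal branch), and consider the wave equation $c_0^{-2}u_{,tt}+(2/c_0)\,L*u_{,t}+L*L*u=u_{,xx}$, whose propagation function in the Laplace domain is $B(p)=p/c_0+a\,p^{\alpha}$. There is exactly one continuous function $G$ on $]0,\infty[$ whose Laplace transform converges absolutely on some right half-plane and equals there $$\tilde G(p)=p^{-1}\bigl[1+c_0a\,p^{\alpha-1}\bigr]^{-2};$$ it is the relaxation modulus induced by $B$, i.e. $p\,\tilde G(p)\,B(p)^2=p^2/c_0^2$ for $\operatorname{Re}p$ large. A function $G$ on $]0,\infty[$ is called completely monotone if it is $C^\infty$ and $(-1)^nG^{(n)}(t)\ge 0$ for all $n\ge 0$, $t>0$; a differentiable function $f\ge 0$ on $]0,\infty[$ is called a Bernstein function if $f'$ is completely monotone. Let $$f=\theta+\frac{2c_0a\,t_+^{1-\alpha}}{\Gamma(2-\alpha)}+\frac{c_0^2a^2\,t_+^{2(1-\alpha)}}{\Gamma(3-2\alpha)},$$ where $\theta$ is the unit step and $t_+^{s}/\Gamma(s+1)$ is the homogeneous distribution (an ordinary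 function if $s>-1$, a distributional derivative of such a function otherwise). Then: 1. The Laplace transform of $f$ is $\bigl[1+c_0a\,p^{\alpha-1}\bigr]^{2}/p$ for $\operatorname{Re}p>0$. 2. $G$ is completely monotone if and only if the distribution $f$ is a Bernstein function (extended by $0$ to $t\le 0$). If $\alpha<1$, then $f$ is the ordinary function given by the formula above, and it is a Bernstein function if and only if $\alpha\ge 1/2$. 3. If $\alpha\ne 1$, then $G$ is completely monotone if and only if $1/2\le\alpha<1$. 4. If $\alpha<1/2$, then the dispersion-attenuation function $b(p)=a\,p^{\alpha}$ is admissible, i.e. $b(p)=p\int_{]0,\infty[}\frac{\nu(\mathrm dr)}{p+r}$ on the complex plane cut along the negative real axis, for some positive measure $\nu$ on $]0,\infty[$ with $\int_{]0,\infty[}\frac{\nu(\mathrm dr)}{1+r}<\infty$, while $G$ is not completely monotone. -/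

import Mathlib

open Set MeasureTheory
open scoped ContDiff

noncomputable section

namespace PowerLaw

/-- A function on `]0,∞[` is completely monotone: it is smooth there and
`(-1)^n Dⁿ G ≥ 0` for all `n ≥ 0`.  Only the values on `]0,∞[` matter. -/
def CompletelyMonotone (G : ℝ → ℝ) : Prop :=
  ContDiffOn ℝ ∞ G (Ioi 0) ∧ ∀ (n : ℕ) (t : ℝ), 0 < t → 0 ≤ (-1) ^ n * iteratedDeriv n G t

/-- A Bernstein function on `]0,∞[`: differentiable, nonnegative, with completely monotone
derivative. -/
def IsBernstein (f : ℝ → ℝ) : Prop :=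
  DifferentiableOn ℝ f (Ioi 0) ∧ (∀ t : ℝ, 0 < t → 0 ≤ f t) ∧ CompletelyMonotone (deriv f)

/-- The Laplace transform `∫₀^∞ G(t) e^{-pt} dt`. -/
def laplace (G : ℝ → ℝ) (p : ℂ) : ℂ :=
  ∫ t in Ioi (0 : ℝ), Complex.exp (-p * t) * (G t : ℂ)

/-- `G` is an inverse Laplace transform of `F`: on some right half-plane the Laplace integral of
`G` converges absolutely and equals `F`. -/
def IsInverseLaplace (G : ℝ → ℝ) (F : ℂ → ℂ) : Prop :=
  ∃ σ : ℝ, ∀ p : ℂ, σ < p.re →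
    IntegrableOn (fun t : ℝ => Complex.exp (-p * t) * (G t : ℂ)) (Ioi 0) ∧ laplace G p = F p

/-- The power-law dispersion-attenuation function `b(p) = L̃(p) = a p^α` (principal branch). -/
def attenuation (a α : ℝ) (p : ℂ) : ℂ := (a : ℂ) * p ^ (α : ℂ)

/-- `B(p) = p / c₀ + a p^α`. -/
def waveB (c₀ a α : ℝ) (p : ℂ) : ℂ := p / (c₀ : ℂ) + attenuation a α p

/-- A dispersion-attenuation function is admissible if `b(p) = p ∫_{]0,∞[} ν(dr) / (p + r)` on the
plane cut along the negative real axis, for a positive measure `ν` on `]0,∞[` with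
`∫ ν(dr) / (1 + r) < ∞`. -/
def IsAdmissible (b : ℂ → ℂ) : Prop :=
  ∃ ν : Measure ℝ,
    (∫⁻ r in Ioi (0 : ℝ), ENNReal.ofReal (1 / (1 + r)) ∂ν) < ⊤ ∧
    ∀ p ∈ Complex.slitPlane, b p = p * ∫ r in Ioi (0 : ℝ), 1 / (p + (r : ℂ)) ∂ν

/-- The homogeneous distribution `t₊^s / Γ(s + 1)`, as a functional of `φ`.  It is the `m`-th
distributional derivative of the locally integrable function `t₊^(s+m) / Γ(s + m + 1)`, where `m`
is the least natural number with `s + m > -1`; in particular for `s > -1` it is integration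
against `t₊^s / Γ(s + 1)`, and for `s = -1, -2, …` it is `δ, δ', …`. -/
def homDist (s : ℝ) (φ : ℝ → ℂ) : ℂ :=
  (-1) ^ ⌊-s⌋₊ * ∫ t in Ioi (0 : ℝ),
    ((t ^ (s + ⌊-s⌋₊) / Real.Gamma (s + ⌊-s⌋₊ + 1) : ℝ) : ℂ) * iteratedDeriv ⌊-s⌋₊ φ t

/-- The distribution
`f = θ + 2 c₀ a t₊^(1-α) / Γ(2-α) + c₀² a² t₊^(2(1-α)) / Γ(3-2α)`. -/
def fDist (c₀ a α : ℝ) (φ : ℝ → ℂ) : ℂ :=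
  homDist 0 φ + 2 * (c₀ : ℂ) * (a : ℂ) * homDist (1 - α) φ
    + (c₀ : ℂ) ^ 2 * (a : ℂ) ^ 2 * homDist (2 * (1 - α)) φ

/-- The same `f` as an ordinary function of `t > 0`. -/
def fFun (c₀ a α : ℝ) (t : ℝ) : ℝ :=
  1 + 2 * c₀ * a * t ^ (1 - α) / Real.Gamma (2 - α)
    + c₀ ^ 2 * a ^ 2 * t ^ (2 * (1 - α)) / Real.Gamma (3 - 2 * α)

/-- A distribution on `ℝ` is a Bernstein function (extended by `0` to `t ≤ 0`): it is integration
against some Bernstein function over `]0,∞[`. -/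
def DistIsBernstein (T : (ℝ → ℂ) → ℂ) : Prop :=
  ∃ g : ℝ → ℝ, IsBernstein g ∧
    ∀ φ : ℝ → ℂ, ContDiff ℝ ∞ φ → HasCompactSupport φ →
      T φ = ∫ t in Ioi (0 : ℝ), (g t : ℂ) * φ t

end PowerLaw

end

open Filter Topology

namespace PowerLaw

/-! ### Laplace transforms of powers and of homogeneous distributions. -/

section LaplaceOfPowers

/-! Put K = c₀ a and β = 1 - α. The equivalence between `G` and `f` is not drawn from a general
duality: each side is decided separately, and both hold exactly when 1/2 ≤ α ≤ 1
(`completelyMonotone_relaxationModulus_iff`, `distIsBernstein_fDist_iff`).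

Existence of `G`: far to the right the transform is a binomial series in p^(-|β|), which is inverted
term by term (`exists_relaxationModulus`). Uniqueness is Fourier inversion
(`IsInverseLaplace.eqOn`).

For 0 < α < 1 the transform is analytic on the cut plane, hence the Cauchy integral of its jump
across the cut (`integral_jumpIntegrand`). This gives G(t) = ∫ e^(-rt) w(log r) dr/r, where w has
the sign of 1 + K r^(-β) cos(βπ). If β ≤ 1/2 then w ≥ 0 and `G` is completely monotone. If α < 1/2
the transform is O(r^(1-2α)) as r → 0+, so it tends to 0, whereas the transform of a nonnegative
function can only grow as r decreases. For α = 1, `G` is a positive constant. For α > 1, G(0+) = 0,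
so a nonnegative nonincreasing `G` would vanish identically.

On the other side, for α ≤ 1 the derivative of `f` is a nonnegative combination of t^(-α) and
t^(1-2α). Both exponents are nonpositive when α ≥ 1/2; when α < 1/2 the second term makes f'
eventually increasing. For α > 1, testing against φ(lt) exposes a growth l^(2(α-1)) that no
Bernstein function allows (`not_distIsBernstein_fDist`).

Admissibility of a p^α comes from the same Cauchy formula, applied to p^(α-1). -/

lemma norm_exp_neg_mul_ofReal (p : ℂ) (t : ℝ) :
    ‖Complex.exp (-p * t)‖ = Real.exp (-(p.re * t)) := by
  rw [Complex.norm_exp]; simp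

lemma integrableOn_exp_mul_rpow {s : ℝ} (hs : -1 < s) {σ : ℝ} (hσ : 0 < σ) :
    IntegrableOn (fun t : ℝ => Real.exp (-(σ * t)) * t ^ s) (Ioi 0) := by
  have h := integrableOn_rpow_mul_exp_neg_mul_rpow hs one_pos hσ
  refine h.congr_fun (fun t _ => ?_) measurableSet_Ioi
  simp [mul_comm]

lemma integrableOn_cexp_mul_rpow {s : ℝ} (hs : -1 < s) {p : ℂ} (hp : 0 < p.re) :
    IntegrableOn (fun t : ℝ => Complex.exp (-p * t) * ((t ^ s : ℝ) : ℂ)) (Ioi 0) := by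
  refine (integrableOn_exp_mul_rpow hs hp).mono' (by fun_prop) ?_
  refine (ae_restrict_iff' measurableSet_Ioi).2 (ae_of_all _ fun t (ht : 0 < t) => ?_)
  rw [norm_mul, norm_exp_neg_mul_ofReal, Complex.norm_real, Real.norm_of_nonneg (by positivity)]

lemma differentiableOn_integral_cexp_mul_rpow {s : ℝ} (hs : -1 < s) :
    DifferentiableOn ℂ (fun p : ℂ => ∫ t in Ioi (0 : ℝ), Complex.exp (-p * t) * ((t ^ s : ℝ) : ℂ))
      {p | 0 < p.re} := by
  intro p (hp : 0 < p.re)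
  have hb : 0 < p.re / 2 := by positivity
  have hmem : {q : ℂ | p.re / 2 < q.re} ∈ 𝓝 p :=
    (isOpen_lt continuous_const Complex.continuous_re).mem_nhds (by simp; linarith)
  refine (hasDerivAt_integral_of_dominated_loc_of_deriv_le
    (μ := volume.restrict (Ioi 0))
    (F := fun q t => Complex.exp (-q * t) * ((t ^ s : ℝ) : ℂ))
    (F' := fun q t => -(t : ℂ) * (Complex.exp (-q * t) * ((t ^ s : ℝ) : ℂ)))
    (bound := fun t => Real.exp (-(p.re / 2 * t)) * t ^ (s + 1)) hmem
    (Eventually.of_forall fun q => ?_) (integrableOn_cexp_mul_rpow hs hp) ?_ ?_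
    (integrableOn_exp_mul_rpow (by linarith) hb) ?_).2.differentiableAt.differentiableWithinAt
  · fun_prop
  · fun_prop
  · refine (ae_restrict_iff' measurableSet_Ioi).2 (ae_of_all _ fun t (ht : 0 < t) q hq => ?_)
    have hq : p.re / 2 < q.re := hq
    rw [norm_mul, norm_mul, norm_exp_neg_mul_ofReal, Complex.norm_real, norm_neg, Complex.norm_real,
      Real.norm_of_nonneg ht.le, Real.norm_of_nonneg (by positivity), Real.rpow_add_one ht.ne']
    have : Real.exp (-(q.re * t)) ≤ Real.exp (-(p.re / 2 * t)) := by gcongr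
    have h2 : 0 ≤ t * t ^ s := by positivity
    nlinarith
  · refine ae_of_all _ fun t q _ => ?_
    have h : HasDerivAt (fun q : ℂ => -q * t) (-(t : ℂ)) q := by
      simpa using (hasDerivAt_id q).neg.mul_const (t : ℂ)
    convert! h.cexp.mul_const ((t ^ s : ℝ) : ℂ) using 1
    ring

lemma slitPlane_of_re_pos {p : ℂ} (hp : 0 < p.re) : p ∈ Complex.slitPlane := Or.inl hp

/-- For real p this is Euler's integral; both sides are analytic on the right half-plane, so the
identity theorem extends it. -/
lemma integral_cexp_mul_rpow {s : ℝ} (hs : -1 < s) {p : ℂ} (hp : 0 < p.re) :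
    ∫ t in Ioi (0 : ℝ), Complex.exp (-p * t) * ((t ^ s : ℝ) : ℂ) =
      Real.Gamma (s + 1) * p ^ (-((s : ℂ) + 1)) := by
  have hU : IsOpen {p : ℂ | 0 < p.re} := isOpen_lt continuous_const Complex.continuous_re
  have hg : DifferentiableOn ℂ (fun p : ℂ => (Real.Gamma (s + 1) : ℂ) * p ^ (-((s : ℂ) + 1)))
      {p | 0 < p.re} := fun q hq =>
    ((differentiableAt_id.cpow_const (slitPlane_of_re_pos hq)).const_mul _).differentiableWithinAt
  have hpre : IsPreconnected {p : ℂ | 0 < p.re} := (convex_halfSpace_re_gt 0).isPreconnected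
  refine ((differentiableOn_integral_cexp_mul_rpow hs).analyticOnNhd
    hU).eqOn_of_preconnected_of_frequently_eq (hg.analyticOnNhd hU) hpre
    (show (1 : ℂ) ∈ _ by simp) ?_ hp
  have hev : ∀ r : ℝ, 0 < r → ∫ t in Ioi (0 : ℝ), Complex.exp (-(r : ℂ) * t) * ((t ^ s : ℝ) : ℂ) =
      Real.Gamma (s + 1) * (r : ℂ) ^ (-((s : ℂ) + 1)) := by
    intro r hr
    have h := Real.integral_rpow_mul_exp_neg_mul_Ioi (a := s + 1) (by linarith) hr
    have h1 : ∫ t in Ioi (0 : ℝ), Complex.exp (-(r : ℂ) * t) * ((t ^ s : ℝ) : ℂ) =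
        ((∫ t in Ioi (0 : ℝ), t ^ (s + 1 - 1) * Real.exp (-(r * t)) : ℝ) : ℂ) := by
      rw [← integral_complex_ofReal]
      refine setIntegral_congr_fun measurableSet_Ioi fun t _ => ?_
      simp only [add_sub_cancel_right]
      push_cast
      rw [mul_comm]; simp
    rw [h1, h, one_div, Real.inv_rpow hr.le, ← Real.rpow_neg hr.le]
    push_cast
    rw [Complex.ofReal_cpow hr.le]
    push_cast
    ring
  -- Real points 1 + 1/(n+1) accumulate at 1, which suffices for the identity theorem.
  have htend : Tendsto (fun n : ℕ => (((1 : ℝ) + 1 / ((n : ℝ) + 1) : ℝ) : ℂ)) atTop (𝓝[≠] 1) := by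
    refine tendsto_nhdsWithin_iff.2 ⟨?_, Eventually.of_forall fun n => ?_⟩
    · have := (tendsto_one_div_add_atTop_nhds_zero_nat (𝕜 := ℝ)).const_add 1
      rw [add_zero] at this
      exact_mod_cast (Complex.continuous_ofReal.tendsto 1).comp this
    · have : (0 : ℝ) < 1 / ((n : ℝ) + 1) := by positivity
      intro h
      have h := congrArg Complex.re h
      simp only [Complex.ofReal_re, Complex.one_re] at h
      linarith
  exact htend.frequently (Frequently.of_forall fun n => hev _ (by positivity))

lemma integral_cexp_mul_rpow_div_Gamma {s : ℝ} (hs : -1 < s) {p : ℂ} (hp : 0 < p.re) :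
    ∫ t in Ioi (0 : ℝ), Complex.exp (-p * t) * ((t ^ s / Real.Gamma (s + 1) : ℝ) : ℂ) =
      p ^ (-((s : ℂ) + 1)) := by
  have hG : (Real.Gamma (s + 1) : ℂ) ≠ 0 := by
    exact_mod_cast (Real.Gamma_pos_of_pos (by linarith)).ne'
  have := integral_cexp_mul_rpow hs hp
  push_cast at this ⊢
  simp_rw [← mul_div_assoc]
  rw [integral_div, this]
  field_simp

/-- Each derivative of the exponential produces -p; with the sign (-1)^m this gives p^m, which
undoes the shift of the exponent from s to s + m. -/
lemma homDist_exp (s : ℝ) {p : ℂ} (hp : 0 < p.re) :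
    homDist s (fun t : ℝ => Complex.exp (-p * t)) = p ^ (-((s : ℂ) + 1)) := by
  have hp0 : p ≠ 0 := by rintro rfl; simp at hp
  have hder : ∀ m : ℕ, iteratedDeriv m (fun t : ℝ => Complex.exp (-p * t)) =
      fun t : ℝ => (-p) ^ m * Complex.exp (-p * t) := by
    intro m
    induction m with
    | zero => simp
    | succ m ih =>
      rw [iteratedDeriv_succ, ih]
      funext t
      have h : HasDerivAt (fun t : ℝ => -p * (t : ℂ)) (-p) t := by
        simpa using (Complex.ofRealCLM.hasDerivAt (x := t)).const_mul (-p)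
      rw [(h.cexp.const_mul ((-p) ^ m)).deriv]
      ring
  have hm : -1 < s + ⌊-s⌋₊ := by
    have := Nat.lt_floor_add_one (-s); linarith
  unfold homDist
  rw [hder]
  set m := ⌊-s⌋₊
  have h : ∀ t : ℝ, ((t ^ (s + m) / Real.Gamma (s + m + 1) : ℝ) : ℂ) *
      ((-p) ^ m * Complex.exp (-p * t)) = (-p) ^ m * (Complex.exp (-p * t) *
        ((t ^ (s + m) / Real.Gamma (s + m + 1) : ℝ) : ℂ)) := fun t => by ring
  simp_rw [h]
  rw [integral_const_mul, integral_cexp_mul_rpow_div_Gamma hm hp, ← mul_assoc, ← mul_pow,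
    show -1 * -p = p by ring, ← Complex.cpow_natCast, ← Complex.cpow_add _ _ (by simpa using hp0)]
  push_cast
  congr 1; ring

lemma fDist_exp (c₀ a α : ℝ) {p : ℂ} (hp : 0 < p.re) :
    fDist c₀ a α (fun t : ℝ => Complex.exp (-p * t)) =
      (1 + (c₀ : ℂ) * (a : ℂ) * p ^ ((α : ℂ) - 1)) ^ 2 / p := by
  have hp0 : p ≠ 0 := by rintro rfl; simp at hp
  unfold fDist
  rw [homDist_exp _ hp, homDist_exp _ hp, homDist_exp _ hp]
  push_cast
  have h1 : p ^ (-((0 : ℂ) + 1)) = p⁻¹ := by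
    rw [zero_add, Complex.cpow_neg, Complex.cpow_one]
  have h2 : p ^ (-((1 - α : ℂ) + 1)) = p ^ ((α : ℂ) - 1) * p⁻¹ := by
    rw [← h1, ← Complex.cpow_add _ _ hp0]; congr 1; ring
  have h3 : p ^ (-((2 * (1 - α) : ℂ) + 1)) = p ^ ((α : ℂ) - 1) * p ^ ((α : ℂ) - 1) * p⁻¹ := by
    rw [← h1, ← Complex.cpow_add _ _ hp0, ← Complex.cpow_add _ _ hp0]; congr 1; ring
  rw [h1, h2, h3]
  field_simp
  ring

end LaplaceOfPowers

/-! ### Uniqueness of the inverse Laplace transform. -/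

section Uniqueness

lemma integrableOn_exp_ofReal_sub {G₁ G₂ : ℝ → ℝ} {p : ℂ}
    (h₁ : IntegrableOn (fun t : ℝ => Complex.exp (-p * t) * (G₁ t : ℂ)) (Ioi 0))
    (h₂ : IntegrableOn (fun t : ℝ => Complex.exp (-p * t) * (G₂ t : ℂ)) (Ioi 0)) :
    IntegrableOn (fun t : ℝ => Complex.exp (-p * t) * ((G₁ t - G₂ t : ℝ) : ℂ)) (Ioi 0) := by
  refine (Integrable.sub h₁ h₂).congr (ae_of_all _ fun t => ?_)
  simp [mul_sub]

/-- A continuous function on `]0,∞[` is determined by its Laplace transform. -/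
lemma IsInverseLaplace.eqOn {G₁ G₂ : ℝ → ℝ} {F : ℂ → ℂ} (hc₁ : ContinuousOn G₁ (Ioi 0))
    (hc₂ : ContinuousOn G₂ (Ioi 0)) (h₁ : IsInverseLaplace G₁ F) (h₂ : IsInverseLaplace G₂ F) :
    EqOn G₁ G₂ (Ioi 0) := by
  obtain ⟨σ₁, h₁⟩ := h₁
  obtain ⟨σ₂, h₂⟩ := h₂
  set σ := max σ₁ σ₂ + 1
  have hσ₁ : σ₁ < σ := by have := le_max_left σ₁ σ₂; simp only [σ]; linarith
  have hσ₂ : σ₂ < σ := by have := le_max_right σ₁ σ₂; simp only [σ]; linarith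
  -- The damped difference, extended by 0: its Fourier transform at w is the difference of the two
  -- Laplace transforms at σ + 2πiw, hence zero.
  set h : ℝ → ℂ := (Ioi (0 : ℝ)).indicator
    fun t => Complex.exp (-(σ : ℂ) * t) * ((G₁ t - G₂ t : ℝ) : ℂ) with hdef
  have hint : Integrable h := by
    rw [integrable_indicator_iff measurableSet_Ioi]
    exact integrableOn_exp_ofReal_sub (h₁ σ (by simpa)).1 (h₂ σ (by simpa)).1
  have hF : FourierTransform.fourier h = 0 := by
    funext w
    rw [Real.fourier_real_eq_integral_exp_smul]
    set p : ℂ := σ + 2 * Real.pi * w * Complex.I with hp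
    have hre : p.re = σ := by simp [hp]
    have e : (fun v : ℝ => Complex.exp (((-2 * Real.pi * v * w : ℝ) : ℂ) * Complex.I) • h v) =
        (Ioi (0 : ℝ)).indicator
          fun t => Complex.exp (-p * t) * ((G₁ t : ℂ)) - Complex.exp (-p * t) * ((G₂ t : ℂ)) := by
      funext v
      by_cases hv : v ∈ Ioi (0 : ℝ)
      · simp only [hdef, indicator_of_mem hv, smul_eq_mul, ← mul_assoc, ← Complex.exp_add]
        rw [← mul_sub, ← Complex.ofReal_sub]
        congr 2
        rw [hp]; push_cast; ring
      · simp [hdef, indicator_of_notMem hv]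
    rw [e, integral_indicator measurableSet_Ioi,
      integral_sub (h₁ p (by rwa [hre])).1 (h₂ p (by rwa [hre])).1]
    have e₁ := (h₁ p (by rwa [hre])).2
    have e₂ := (h₂ p (by rwa [hre])).2
    simp only [laplace] at e₁ e₂
    rw [e₁, e₂, sub_self]; rfl
  intro t ht
  have hcont : ContinuousAt h t := by
    have : ContinuousAt (fun t : ℝ => Complex.exp (-(σ : ℂ) * t) * ((G₁ t - G₂ t : ℝ) : ℂ)) t := by
      refine ContinuousAt.mul (by fun_prop) (Complex.continuous_ofReal.continuousAt.comp ?_)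
      exact ((hc₁.sub hc₂).continuousAt (Ioi_mem_nhds ht))
    refine this.congr ?_
    filter_upwards [Ioi_mem_nhds ht] with s hs
    rw [hdef, indicator_of_mem hs]
  -- Inversion holds pointwise where h is continuous, so the conclusion holds at every t > 0 and not
  -- just almost everywhere.
  have key := hint.fourierInv_fourier_eq (by rw [hF]; exact integrable_zero _ _ _) hcont
  rw [hF] at key
  have hz : (FourierTransformInv.fourierInv (0 : ℝ → ℂ)) t = 0 := by
    rw [Real.fourierInv_eq]; simp
  rw [hz, hdef, indicator_of_mem ht] at key
  have := (mul_eq_zero.1 key.symm).resolve_left (Complex.exp_ne_zero _)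
  have := Complex.ofReal_eq_zero.1 this
  linarith

end Uniqueness

/-! ### Series in powers of t^β and their Laplace transforms. -/

section Series

/-- Restrict the Gamma integral to t > R, where t^x ≥ R^x. This crude lower bound on Gamma replaces
Stirling's formula in the convergence estimates. -/
lemma rpow_le_exp_mul_Gamma {x R : ℝ} (hx : 0 ≤ x) (hR : 0 ≤ R) :
    R ^ x ≤ Real.exp R * Real.Gamma (x + 1) := by
  have hint : IntegrableOn (fun t : ℝ => Real.exp (-t) * t ^ x) (Ioi 0) := by
    simpa using integrableOn_exp_mul_rpow (s := x) (by linarith) one_pos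
  have hsub : Ioi R ⊆ Ioi 0 := Ioi_subset_Ioi hR
  have h1 : ∫ t in Ioi R, Real.exp (-t) * t ^ x ≤ Real.Gamma (x + 1) := by
    rw [Real.Gamma_eq_integral (by linarith)]
    simp only [add_sub_cancel_right]
    refine setIntegral_mono_set hint ?_ hsub.eventuallyLE
    exact (ae_restrict_iff' measurableSet_Ioi).2 (ae_of_all _ fun t (ht : 0 < t) => by
      simp only [Pi.zero_apply]; positivity)
  have h2 : ∫ t in Ioi R, Real.exp (-t) * R ^ x ≤ ∫ t in Ioi R, Real.exp (-t) * t ^ x := by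
    refine setIntegral_mono_on ((integrableOn_exp_neg_Ioi R).mul_const _) (hint.mono_set hsub)
      measurableSet_Ioi fun t (ht : R < t) => ?_
    gcongr
  rw [integral_mul_const, integral_exp_neg_Ioi] at h2
  have h3 := h2.trans h1
  calc R ^ x = Real.exp R * (Real.exp (-R) * R ^ x) := by
        rw [← mul_assoc, ← Real.exp_add]; simp
    _ ≤ _ := by gcongr

/-- The series `∑ cₙ t^(nβ) / Γ(nβ + 1)`. -/
noncomputable def powerSeriesModulus (c : ℕ → ℝ) (β : ℝ) (t : ℝ) : ℝ :=
  ∑' n : ℕ, c n * (t ^ (n * β) / Real.Gamma (n * β + 1))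

variable {c : ℕ → ℝ} {β C M : ℝ}

lemma exists_two_mul_le_rpow (hβ : 0 < β) (hM : 0 < M) : ∃ l : ℝ, 0 < l ∧ 2 * M = l ^ β :=
  ⟨(2 * M) ^ β⁻¹, by positivity, by
    rw [← Real.rpow_mul (by positivity), inv_mul_cancel₀ hβ.ne', Real.rpow_one]⟩

/-- Apply the Gamma bound with R = l|t|. Taking l^β = 2M rather than M leaves the factor 2^(-n),
which gives summability and an exponential growth bound at once. -/
lemma abs_term_le (hβ : 0 < β) (hM : 0 < M) (hC : 0 ≤ C) (hc : ∀ n, |c n| ≤ C * M ^ n) {l : ℝ}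
    (hl : 0 < l) (hlM : 2 * M = l ^ β) (n : ℕ) (t : ℝ) :
    ‖c n * (t ^ (n * β) / Real.Gamma (n * β + 1))‖ ≤ C * Real.exp (l * |t|) * (1 / 2) ^ n := by
  have hx : 0 ≤ n * β := by positivity
  have hG : 0 < Real.Gamma (n * β + 1) := Real.Gamma_pos_of_pos (by positivity)
  have h1 := rpow_le_exp_mul_Gamma hx (show 0 ≤ l * |t| by positivity)
  rw [Real.mul_rpow hl.le (abs_nonneg _), mul_comm (n : ℝ) β, Real.rpow_mul hl.le, ← hlM,
    Real.rpow_natCast] at h1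
  rw [mul_comm (n : ℝ) β] at hG ⊢
  rw [norm_mul, norm_div, Real.norm_eq_abs, Real.norm_eq_abs, Real.norm_of_nonneg hG.le]
  have h2 : |t ^ (β * n)| / Real.Gamma (β * n + 1) ≤ Real.exp (l * |t|) / (2 * M) ^ n := by
    rw [div_le_div_iff₀ hG (by positivity)]
    calc _ ≤ |t| ^ (β * n) * (2 * M) ^ n := by gcongr; exact Real.abs_rpow_le_abs_rpow _ _
      _ ≤ _ := by linarith
  calc _ ≤ C * M ^ n * (Real.exp (l * |t|) / (2 * M) ^ n) := by gcongr; exact hc n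
    _ = _ := by rw [mul_pow, div_pow, one_pow]; field_simp

lemma continuous_powerSeriesModulus (hβ : 0 < β) (hM : 0 < M) (hC : 0 ≤ C)
    (hc : ∀ n, |c n| ≤ C * M ^ n) : Continuous (powerSeriesModulus c β) := by
  obtain ⟨l, hl, hlM⟩ := exists_two_mul_le_rpow hβ hM
  refine continuous_iff_continuousAt.2 fun t => ?_
  have hon : ContinuousOn (powerSeriesModulus c β) (Ioo (t - 1) (t + 1)) := by
    refine continuousOn_tsum (u := fun n => C * Real.exp (l * (|t| + 1)) * (1 / 2) ^ n)
      (fun n => ?_) ?_ fun n s hs => ?_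
    · exact (continuous_const.mul
        ((Real.continuous_rpow_const (by positivity)).div_const _)).continuousOn
    · exact (summable_geometric_of_lt_one (by norm_num) (by norm_num)).mul_left _
    · refine (abs_term_le hβ hM hC hc hl hlM n s).trans ?_
      have : |s| ≤ |t| + 1 := by
        have h1 := abs_sub_abs_le_abs_sub s t
        have h2 : |s - t| < 1 := abs_lt.2 ⟨by linarith [hs.1], by linarith [hs.2]⟩
        linarith
      gcongr
  exact hon.continuousAt (Ioo_mem_nhds (by linarith) (by linarith))

lemma powerSeriesModulus_zero (hβ : 0 < β) : powerSeriesModulus c β 0 = c 0 := by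
  unfold powerSeriesModulus
  rw [tsum_eq_single 0]
  · simp
  · intro n hn
    rw [Real.zero_rpow (by positivity)]; simp

/-- The Laplace transform of the series, term by term. -/
lemma exists_hasSum_laplace_powerSeriesModulus (hβ : 0 < β) (hM : 0 < M) (hC : 0 ≤ C)
    (hc : ∀ n, |c n| ≤ C * M ^ n) : ∃ σ : ℝ, 0 < σ ∧ ∀ p : ℂ, σ < p.re →
      IntegrableOn (fun t : ℝ => Complex.exp (-p * t) * (powerSeriesModulus c β t : ℂ)) (Ioi 0) ∧
      HasSum (fun n : ℕ => (c n : ℂ) * p ^ (-((n * β : ℝ) + 1 : ℂ)))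
        (laplace (powerSeriesModulus c β) p) := by
  obtain ⟨l, hl, hlM⟩ := exists_two_mul_le_rpow hβ hM
  refine ⟨l, hl, fun p hp => ⟨?_, ?_⟩⟩
  · have hb : ∀ t : ℝ, |powerSeriesModulus c β t| ≤ C * Real.exp (l * |t|) * 2 := fun t => by
      refine tsum_of_norm_bounded (g := fun n : ℕ => C * Real.exp (l * |t|) * (1 / 2) ^ n) ?_
        fun n => abs_term_le hβ hM hC hc hl hlM n t
      exact hasSum_geometric_two.mul_left _
    have hcont := continuous_powerSeriesModulus hβ hM hC hc
    have hi : IntegrableOn (fun t : ℝ => 2 * C * Real.exp (-(p.re - l) * t)) (Ioi 0) :=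
      (integrableOn_exp_mul_Ioi (by linarith) 0).const_mul _
    refine hi.mono' (by fun_prop) ?_
    refine (ae_restrict_iff' measurableSet_Ioi).2 (ae_of_all _ fun t (ht : 0 < t) => ?_)
    rw [norm_mul, norm_exp_neg_mul_ofReal, Complex.norm_real, Real.norm_eq_abs]
    calc _ ≤ Real.exp (-(p.re * t)) * (C * Real.exp (l * |t|) * 2) := by gcongr; exact hb t
      _ = _ := by
        rw [abs_of_pos ht, show -(p.re - l) * t = -(p.re * t) + l * t by ring, Real.exp_add]; ring
  · have hp0 : 0 < p.re := hl.trans hp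
    have hs : ∀ n : ℕ, -1 < (n * β : ℝ) := fun n => by
      have : (0 : ℝ) ≤ n * β := by positivity
      linarith
    set F : ℕ → ℝ → ℂ := fun n t => (c n : ℂ) * (Complex.exp (-p * t) *
      ((t ^ (n * β) / Real.Gamma (n * β + 1) : ℝ) : ℂ)) with hF
    have hFi : ∀ n, Integrable (F n) (volume.restrict (Ioi 0)) := fun n => by
      have := ((integrableOn_cexp_mul_rpow (hs n) hp0).div_const
        (Real.Gamma (n * β + 1) : ℂ)).const_mul (c n : ℂ)
      refine this.congr (ae_of_all _ fun t => ?_)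
      simp only [hF]; push_cast; ring
    have hFn : ∀ n, ∫ t in Ioi (0 : ℝ), ‖F n t‖ = |c n| * p.re ^ (-(n * β + 1)) := fun n => by
      have hG : 0 < Real.Gamma (n * β + 1) := Real.Gamma_pos_of_pos (by linarith [hs n])
      have h := Real.integral_rpow_mul_exp_neg_mul_Ioi (a := n * β + 1) (by linarith [hs n]) hp0
      have e : ∀ t ∈ Ioi (0 : ℝ), ‖F n t‖ = |c n| / Real.Gamma (n * β + 1) *
          (t ^ (n * β + 1 - 1) * Real.exp (-(p.re * t))) := fun t (ht : 0 < t) => by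
        rw [hF]
        simp only [norm_mul, norm_exp_neg_mul_ofReal, Complex.norm_real, Real.norm_eq_abs]
        rw [abs_of_nonneg (a := t ^ _ / _) (by positivity), add_sub_cancel_right]; ring
      rw [setIntegral_congr_fun measurableSet_Ioi e, integral_const_mul, h, one_div,
        Real.inv_rpow hp0.le, ← Real.rpow_neg hp0.le]
      field_simp
    have hsum : Summable fun n => ∫ t in Ioi (0 : ℝ), ‖F n t‖ := by
      refine Summable.of_nonneg_of_le (fun n => integral_nonneg fun _ => norm_nonneg _) (fun n => ?_)
        ((summable_geometric_of_lt_one (r := 1 / 2) (by norm_num) (by norm_num)).mul_left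
          (C * p.re⁻¹))
      rw [hFn]
      have h1 : p.re ^ (-(n * β + 1)) = p.re⁻¹ * (p.re ^ β)⁻¹ ^ n := by
        rw [neg_add, Real.rpow_add hp0, Real.rpow_neg_one, Real.rpow_neg hp0.le, mul_comm (n : ℝ),
          Real.rpow_mul hp0.le, Real.rpow_natCast, inv_pow, mul_comm]
      -- Since Re p > l and l^β = 2M, the integrated norms are dominated by a geometric series of
      -- ratio 1/2.
      have h2 : (p.re ^ β)⁻¹ ≤ (2 * M)⁻¹ := by
        rw [hlM]; gcongr
      rw [h1]
      calc _ ≤ C * M ^ n * (p.re⁻¹ * (2 * M)⁻¹ ^ n) := by gcongr; exact hc n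
        _ = _ := by simp only [mul_inv, mul_pow, one_div, inv_pow]; field_simp
    have key := hasSum_integral_of_summable_integral_norm hFi hsum
    have e1 : (fun n => ∫ t in Ioi (0 : ℝ), F n t) =
        fun n : ℕ => (c n : ℂ) * p ^ (-((n * β : ℝ) + 1 : ℂ)) := by
      funext n
      simp only [hF]
      rw [integral_const_mul, integral_cexp_mul_rpow_div_Gamma (hs n) hp0]
    rw [e1] at key
    suffices e2 : laplace (powerSeriesModulus c β) p = ∫ t in Ioi (0 : ℝ), ∑' n, F n t by rwa [e2]
    refine setIntegral_congr_fun measurableSet_Ioi fun t _ => ?_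
    simp only [hF, powerSeriesModulus]
    rw [Complex.ofReal_tsum, ← tsum_mul_left]
    refine tsum_congr fun n => ?_
    push_cast; ring

end Series

/-! ### Cauchy integral over the jump across the cut, in the variable z = log p. -/

section JumpIntegral

lemma integrable_exp_neg_mul_abs {δ : ℝ} (hδ : 0 < δ) :
    Integrable (fun u : ℝ => Real.exp (-δ * |u|)) := by
  rw [← integrableOn_univ, ← Iic_union_Ioi (a := (0 : ℝ))]
  refine IntegrableOn.union ?_ ?_
  · refine (integrableOn_exp_mul_Iic hδ 0).congr_fun (fun u (hu : u ≤ 0) => ?_) measurableSet_Iic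
    simp [abs_of_nonpos hu]
  · refine (integrableOn_exp_mul_Ioi (neg_lt_zero.2 hδ) 0).congr_fun
      (fun u (hu : 0 < u) => ?_) measurableSet_Ioi
    simp [abs_of_pos hu]

lemma exists_mul_one_add_le_norm_add {p : ℂ} (hp : p ∈ Complex.slitPlane) :
    ∃ c : ℝ, 0 < c ∧ ∀ r : ℝ, 0 ≤ r → c * (1 + r) ≤ ‖(r : ℂ) + p‖ := by
  obtain ⟨d, hd, hdle⟩ : ∃ d : ℝ, 0 < d ∧ ∀ r : ℝ, 0 ≤ r → d ≤ ‖(r : ℂ) + p‖ := by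
    rcases hp with h | h
    · refine ⟨p.re, h, fun r hr => ?_⟩
      have := Complex.re_le_norm ((r : ℂ) + p)
      simp at this; linarith
    · refine ⟨|p.im|, abs_pos.2 h, fun r _ => ?_⟩
      simpa using Complex.abs_im_le_norm ((r : ℂ) + p)
  refine ⟨(1 + (1 + ‖p‖) / d)⁻¹, by positivity, fun r hr => ?_⟩
  rw [inv_mul_le_iff₀ (by positivity)]
  have h1 : r ≤ ‖(r : ℂ) + p‖ + ‖p‖ := by
    have := norm_sub_le ((r : ℂ) + p) p
    rw [add_sub_cancel_right, Complex.norm_real, Real.norm_of_nonneg hr] at this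
    exact this
  have h2 : (1 + ‖p‖) ≤ (1 + ‖p‖) / d * ‖(r : ℂ) + p‖ := by
    rw [div_mul_eq_mul_div, le_div_iff₀ hd]
    gcongr
    exact hdle r hr
  linarith

lemma norm_ofReal_add_pos {p : ℂ} (hp : p ∈ Complex.slitPlane) {r : ℝ} (hr : 0 ≤ r) :
    0 < ‖(r : ℂ) + p‖ := by
  obtain ⟨c, hc, h⟩ := exists_mul_one_add_le_norm_add hp
  exact lt_of_lt_of_le (by positivity) (h r hr)

lemma abs_im_log_lt_pi {p : ℂ} (hp : p ∈ Complex.slitPlane) : |(Complex.log p).im| < Real.pi := by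
  rw [Complex.log_im]
  exact lt_of_le_of_ne (Complex.abs_arg_le_pi p) fun h => by
    rcases (abs_eq Real.pi_pos.le).1 h with h | h
    · exact (Complex.mem_slitPlane_iff_arg.1 hp).1 h
    · exact absurd h (Complex.neg_pi_lt_arg p).ne'

/-- One strict bound is enough: the imaginary parts then differ by less than 2π. -/
lemma eq_of_exp_eq_exp {z w : ℂ} (hz : |z.im| ≤ Real.pi) (hw : |w.im| < Real.pi)
    (h : Complex.exp z = Complex.exp w) : z = w := by
  obtain ⟨n, hn⟩ := Complex.exp_eq_exp_iff_exists_int.1 h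
  have him : z.im = w.im + n * (2 * Real.pi) := by
    have := congrArg Complex.im hn
    simpa using this
  have hz := abs_le.1 hz
  have hw := abs_lt.1 hw
  have hpi := Real.pi_pos
  have h1 : (n : ℝ) < 1 := by by_contra! h; nlinarith
  have h2 : (-1 : ℝ) < n := by by_contra! h; nlinarith
  have h1 : n < 1 := by exact_mod_cast h1
  have h2 : -1 < n := by exact_mod_cast h2
  obtain rfl : n = 0 := by omega
  simpa using hn

/-- The part of the Cauchy kernel `(Φ z - Φ w) e^z / (e^z - e^w)` with the pole at `w` removed. -/
noncomputable def expKernel (Φ : ℂ → ℂ) (w z : ℂ) : ℂ :=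
  dslope Φ w z * Complex.exp z / dslope Complex.exp w z

variable {Φ : ℂ → ℂ} {w z : ℂ}

lemma expKernel_of_ne (h : z ≠ w) :
    expKernel Φ w z = (Φ z - Φ w) * Complex.exp z / (Complex.exp z - Complex.exp w) := by
  have : z - w ≠ 0 := sub_ne_zero.2 h
  rw [expKernel, dslope_of_ne _ h, dslope_of_ne _ h, slope_def_field, slope_def_field]
  field_simp

lemma dslope_exp_ne_zero (hz : |z.im| ≤ Real.pi) (hw : |w.im| < Real.pi) :
    dslope Complex.exp w z ≠ 0 := by
  rcases eq_or_ne z w with rfl | h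
  · simp [dslope_same, Complex.exp_ne_zero]
  · rw [dslope_of_ne _ h, slope_def_field]
    exact div_ne_zero (sub_ne_zero.2 fun e => h (eq_of_exp_eq_exp hz hw e)) (sub_ne_zero.2 h)

lemma continuousAt_dslope' {f : ℂ → ℂ} (hz : ContinuousAt f z) (hw : DifferentiableAt ℂ f w) :
    ContinuousAt (dslope f w) z := by
  rcases eq_or_ne z w with rfl | h
  · exact continuousAt_dslope_same.2 hw
  · exact (continuousAt_dslope_of_ne h).2 hz

lemma continuousAt_expKernel (hΦ : ∀ z : ℂ, |z.im| ≤ Real.pi → DifferentiableAt ℂ Φ z)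
    (hw : |w.im| < Real.pi) (hz : |z.im| ≤ Real.pi) : ContinuousAt (expKernel Φ w) z :=
  ((continuousAt_dslope' (hΦ z hz).continuousAt (hΦ w hw.le)).mul
    Complex.continuous_exp.continuousAt).div
    (continuousAt_dslope' Complex.continuous_exp.continuousAt Complex.differentiableAt_exp)
    (dslope_exp_ne_zero hz hw)

lemma differentiableAt_expKernel (hΦ : ∀ z : ℂ, |z.im| ≤ Real.pi → DifferentiableAt ℂ Φ z)
    (hw : |w.im| < Real.pi) (hz : |z.im| ≤ Real.pi) (h : z ≠ w) :
    DifferentiableAt ℂ (expKernel Φ w) z :=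
  (((differentiableAt_dslope_of_ne h).2 (hΦ z hz)).mul Complex.differentiableAt_exp).div
    ((differentiableAt_dslope_of_ne h).2 Complex.differentiableAt_exp) (dslope_exp_ne_zero hz hw)

/-- Cauchy–Goursat with {w} as exceptional set: subtracting Φ w makes the kernel continuous at w, so
no residue appears here. -/
lemma expKernel_rectangle (hΦ : ∀ z : ℂ, |z.im| ≤ Real.pi → DifferentiableAt ℂ Φ z)
    (hw : |w.im| < Real.pi) (T : ℝ) :
    (∫ u in (-T)..T, (expKernel Φ w (u + (-Real.pi : ℝ) * Complex.I) -
        expKernel Φ w (u + Real.pi * Complex.I))) +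
      Complex.I * (∫ y in (-Real.pi)..Real.pi, expKernel Φ w ((T : ℝ) + y * Complex.I)) -
      Complex.I * (∫ y in (-Real.pi)..Real.pi, expKernel Φ w ((-T : ℝ) + y * Complex.I)) = 0 := by
  have hpi := Real.pi_pos
  have hcont : ∀ v : ℝ, |v| ≤ Real.pi →
      Continuous fun u : ℝ => expKernel Φ w (u + v * Complex.I) := fun v hv => by
    refine continuous_iff_continuousAt.2 fun u => ?_
    have : ContinuousAt (expKernel Φ w) (u + v * Complex.I) :=
      continuousAt_expKernel hΦ hw (by simpa)
    exact ContinuousAt.comp (f := fun u : ℝ => (u : ℂ) + v * Complex.I) this (by fun_prop)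
  have hstrip : ∀ z : ℂ, z.im ∈ uIcc (-Real.pi) Real.pi → |z.im| ≤ Real.pi := fun z hz => by
    rw [uIcc_of_le (by linarith)] at hz
    exact abs_le.2 hz
  have h := Complex.integral_boundary_rect_eq_zero_of_differentiable_on_off_countable
    (expKernel Φ w) ⟨-T, -Real.pi⟩ ⟨T, Real.pi⟩ {w} (countable_singleton w)
    (fun z hz => (continuousAt_expKernel hΦ hw (hstrip z hz.2)).continuousWithinAt)
    (fun z hz => differentiableAt_expKernel hΦ hw (by
      have := hz.1.2
      simp only [mem_preimage, mem_Ioo] at this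
      rw [min_eq_left (by linarith), max_eq_right (by linarith)] at this
      exact abs_le.2 ⟨this.1.le, this.2.le⟩) hz.2)
  simp only [smul_eq_mul] at h
  rw [← h, intervalIntegral.integral_sub]
  · exact (hcont _ (by rw [abs_neg, abs_of_pos hpi])).intervalIntegrable _ _
  · exact (hcont _ (by rw [abs_of_pos hpi])).intervalIntegrable _ _

/-- Integrand obtained from the jump of `Φ` between the two sides of the strip. -/
noncomputable def jumpIntegrand (Φ : ℂ → ℂ) (p : ℂ) (u : ℝ) : ℂ :=
  (Φ (u + (-Real.pi : ℝ) * Complex.I) - Φ (u + Real.pi * Complex.I)) *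
    (Complex.exp u / (Complex.exp u + p))

lemma cexp_add_neg_pi_mul_I (u : ℝ) :
    Complex.exp (u + (-Real.pi : ℝ) * Complex.I) = -Complex.exp u := by
  rw [Complex.exp_add]; push_cast
  rw [neg_mul, Complex.exp_neg, Complex.exp_pi_mul_I]; norm_num

lemma cexp_add_pi_mul_I (u : ℝ) :
    Complex.exp (u + Real.pi * Complex.I) = -Complex.exp u := by
  rw [Complex.exp_add, Complex.exp_pi_mul_I]; norm_num

/-- On both edges e^z = -e^u, so the denominators agree and the subtracted Φ w cancels. -/
lemma expKernel_sub_expKernel {p : ℂ} (hp : p ∈ Complex.slitPlane) (u : ℝ) :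
    expKernel Φ (Complex.log p) (u + (-Real.pi : ℝ) * Complex.I) -
        expKernel Φ (Complex.log p) (u + Real.pi * Complex.I) = jumpIntegrand Φ p u := by
  have hp0 := Complex.slitPlane_ne_zero hp
  have hl := abs_lt.1 (abs_im_log_lt_pi hp)
  have hne : Complex.exp u + p ≠ 0 := by
    have := norm_ofReal_add_pos hp (Real.exp_pos u).le
    rw [Complex.ofReal_exp] at this
    exact norm_pos_iff.1 this
  rw [expKernel_of_ne, expKernel_of_ne, cexp_add_neg_pi_mul_I, cexp_add_pi_mul_I,
    Complex.exp_log hp0, jumpIntegrand]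
  · have : -Complex.exp u - p ≠ 0 := by rw [← neg_add']; exact neg_ne_zero.2 hne
    rw [show -Complex.exp u - p = -(Complex.exp u + p) by ring]
    field_simp
    ring
  · intro h
    have := congrArg Complex.im h
    simp only [Complex.add_im, Complex.ofReal_im, Complex.mul_I_im, Complex.ofReal_re] at this
    linarith
  · intro h
    have := congrArg Complex.im h
    simp only [Complex.add_im, Complex.ofReal_im, Complex.mul_I_im, Complex.ofReal_re] at this
    linarith

variable {C δ : ℝ}

/-- The weight e^u/|e^u + p| is comparable to e^u/(1 + e^u): bounded for u ≥ 0, at most of order e^u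
for u ≤ 0. These are the two regimes covered by the decay hypotheses. -/
lemma integrable_jumpIntegrand {p : ℂ} (hp : p ∈ Complex.slitPlane)
    (hΦ : ∀ z : ℂ, |z.im| ≤ Real.pi → DifferentiableAt ℂ Φ z) (hδ : 0 < δ)
    (hr : ∀ z : ℂ, |z.im| ≤ Real.pi → 0 ≤ z.re → ‖Φ z‖ ≤ C * Real.exp (-δ * z.re))
    (hl : ∀ z : ℂ, |z.im| ≤ Real.pi → z.re ≤ 0 → ‖Φ z * Complex.exp z‖ ≤ C * Real.exp (δ * z.re)) :
    Integrable (jumpIntegrand Φ p) := by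
  obtain ⟨c, hc, hcle⟩ := exists_mul_one_add_le_norm_add hp
  have hpi := Real.pi_pos
  have hcont : Continuous (jumpIntegrand Φ p) := by
    refine (continuous_congr fun u => expKernel_sub_expKernel hp u).1 ?_
    have hk : ∀ v : ℝ, |v| ≤ Real.pi →
        Continuous fun u : ℝ => expKernel Φ (Complex.log p) (u + v * Complex.I) := fun v hv => by
      refine continuous_iff_continuousAt.2 fun u => ?_
      have : ContinuousAt (expKernel Φ (Complex.log p)) (u + v * Complex.I) :=
        continuousAt_expKernel hΦ (abs_im_log_lt_pi hp) (by simpa)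
      exact ContinuousAt.comp (f := fun u : ℝ => (u : ℂ) + v * Complex.I) this (by fun_prop)
    exact (hk _ (by rw [abs_neg, abs_of_pos hpi])).sub (hk _ (by rw [abs_of_pos hpi]))
  refine ((integrable_exp_neg_mul_abs hδ).const_mul (2 * C / c)).mono'
    hcont.aestronglyMeasurable (ae_of_all _ fun u => ?_)
  have hb : ∀ v : ℝ, |v| ≤ Real.pi → ‖Φ (u + v * Complex.I)‖ * (Real.exp u / (1 + Real.exp u)) ≤
      C * Real.exp (-δ * |u|) := fun v hv => by
    have him : |(u + v * Complex.I : ℂ).im| ≤ Real.pi := by simpa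
    have hre : (u + v * Complex.I : ℂ).re = u := by simp
    have he := Real.exp_pos u
    rcases le_total 0 u with h | h
    · have := hr _ him (by rwa [hre])
      rw [hre] at this
      rw [abs_of_nonneg h]
      have h1 : Real.exp u / (1 + Real.exp u) ≤ 1 := by
        rw [div_le_one (by positivity)]; linarith
      have := norm_nonneg (Φ (u + v * Complex.I))
      nlinarith
    · have := hl _ him (by rwa [hre])
      rw [norm_mul, Complex.norm_exp, hre] at this
      rw [abs_of_nonpos h]
      have h1 : Real.exp u / (1 + Real.exp u) ≤ Real.exp u :=
        div_le_self he.le (by linarith)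
      calc _ ≤ ‖Φ (u + v * Complex.I)‖ * Real.exp u := by gcongr
        _ ≤ _ := this
        _ = _ := by ring_nf
  have h1 := hb (-Real.pi) (by rw [abs_neg, abs_of_pos hpi])
  have h2 := hb Real.pi (by rw [abs_of_pos hpi])
  have h3 := norm_sub_le (Φ (u + (-Real.pi : ℝ) * Complex.I)) (Φ (u + Real.pi * Complex.I))
  have h4 := hcle (Real.exp u) (Real.exp_pos u).le
  rw [Complex.ofReal_exp] at h4
  have he := Real.exp_pos u
  rw [jumpIntegrand, norm_mul, norm_div, Complex.norm_exp, Complex.ofReal_re]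
  calc _ ≤ (‖Φ (u + (-Real.pi : ℝ) * Complex.I)‖ + ‖Φ (u + Real.pi * Complex.I)‖) *
        (Real.exp u / (c * (1 + Real.exp u))) := by gcongr
    _ = (‖Φ (u + (-Real.pi : ℝ) * Complex.I)‖ * (Real.exp u / (1 + Real.exp u)) +
        ‖Φ (u + Real.pi * Complex.I)‖ * (Real.exp u / (1 + Real.exp u))) / c := by
      field_simp
    _ ≤ (C * Real.exp (-δ * |u|) + C * Real.exp (-δ * |u|)) / c := by gcongr
    _ = _ := by ring

lemma aestronglyMeasurable_expKernel_vertical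
    (hΦ : ∀ z : ℂ, |z.im| ≤ Real.pi → DifferentiableAt ℂ Φ z) (hw : |w.im| < Real.pi) (T : ℝ) :
    AEStronglyMeasurable (fun y : ℝ => expKernel Φ w (T + y * Complex.I))
      (volume.restrict (uIoc (-Real.pi) Real.pi)) := by
  refine ContinuousOn.aestronglyMeasurable (fun y hy => ?_) measurableSet_uIoc
  rw [uIoc_of_le (by linarith [Real.pi_pos])] at hy
  have : ContinuousAt (expKernel Φ w) (T + y * Complex.I) :=
    continuousAt_expKernel hΦ hw (by simpa using abs_le.2 ⟨hy.1.le, hy.2⟩)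
  exact (ContinuousAt.comp (f := fun y : ℝ => (T : ℂ) + y * Complex.I) this
    (by fun_prop)).continuousWithinAt

/-- On the right Φ tends to 0 and e^z/(e^z - e^w) to 1, so the kernel tends to -Φ w. The residue at
w reappears in this limit. -/
lemma tendsto_integral_expKernel_right
    (hΦ : ∀ z : ℂ, |z.im| ≤ Real.pi → DifferentiableAt ℂ Φ z) (hw : |w.im| < Real.pi) (hδ : 0 < δ)
    (hr : ∀ z : ℂ, |z.im| ≤ Real.pi → 0 ≤ z.re → ‖Φ z‖ ≤ C * Real.exp (-δ * z.re)) :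
    Tendsto (fun T : ℝ => ∫ y in (-Real.pi)..Real.pi, expKernel Φ w (T + y * Complex.I)) atTop
      (𝓝 (-(2 * Real.pi * Φ w))) := by
  have hC : 0 ≤ C := by
    have := (norm_nonneg _).trans (hr 0 (by simp [Real.pi_pos.le]) le_rfl)
    simpa using this
  have hne : ∀ᶠ T : ℝ in atTop, ∀ y : ℝ, (T + y * Complex.I : ℂ) ≠ w := by
    filter_upwards [eventually_gt_atTop w.re] with T hT y h
    rw [← h] at hT; simp at hT
  have hform : ∀ z : ℂ, (Φ z - Φ w) * Complex.exp z / (Complex.exp z - Complex.exp w) =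
      (Φ z - Φ w) / (1 - Complex.exp (w - z)) := fun z => by
    rw [Complex.exp_sub]
    have := Complex.exp_ne_zero z
    rw [one_sub_div this]
    field_simp
  have hlim : ∫ _ in (-Real.pi)..Real.pi, (-Φ w) = -(2 * Real.pi * Φ w) := by
    rw [intervalIntegral.integral_const]
    simp only [Complex.real_smul]
    push_cast; ring
  rw [← hlim]
  refine intervalIntegral.tendsto_integral_filter_of_dominated_convergence
    (fun _ => (C + ‖Φ w‖) * 2)
    (Eventually.of_forall fun T => aestronglyMeasurable_expKernel_vertical hΦ hw T) ?_
    (by simp) ?_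
  · filter_upwards [hne, eventually_ge_atTop (w.re + 1), eventually_ge_atTop 0] with T hT hT1 hT0
    refine ae_of_all _ fun y hy => ?_
    rw [uIoc_of_le (by linarith [Real.pi_pos])] at hy
    rw [expKernel_of_ne (hT y), hform, norm_div]
    have h1 : ‖Φ (T + y * Complex.I)‖ ≤ C := by
      refine (hr _ (by simpa using abs_le.2 ⟨hy.1.le, hy.2⟩) (by simpa)).trans ?_
      have : Real.exp (-δ * T) ≤ 1 := Real.exp_le_one_iff.2 (by nlinarith)
      simpa using mul_le_mul_of_nonneg_left this hC
    have h2 : (1 / 2 : ℝ) ≤ ‖1 - Complex.exp (w - (T + y * Complex.I))‖ := by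
      have := norm_sub_norm_le 1 (Complex.exp (w - (T + y * Complex.I)))
      rw [Complex.norm_exp] at this
      simp only [norm_one, Complex.sub_re, Complex.add_re, Complex.ofReal_re, Complex.mul_I_re,
        Complex.ofReal_im, neg_zero, add_zero] at this
      have h3 : Real.exp (w.re - T) ≤ Real.exp (-1) := Real.exp_le_exp.2 (by linarith)
      have h4 := Real.exp_neg_one_lt_half
      linarith
    calc _ ≤ (C + ‖Φ w‖) / (1 / 2) := by
          gcongr; exact (norm_sub_le _ _).trans (by gcongr)
      _ = _ := by ring
  · refine ae_of_all _ fun y hy => ?_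
    rw [uIoc_of_le (by linarith [Real.pi_pos])] at hy
    have hΦ0 : Tendsto (fun T : ℝ => Φ (T + y * Complex.I)) atTop (𝓝 0) := by
      refine squeeze_zero_norm' (a := fun T => C * Real.exp (-δ * T)) ?_ ?_
      · filter_upwards [eventually_ge_atTop 0] with T hT
        simpa using hr (T + y * Complex.I) (by simpa using abs_le.2 ⟨hy.1.le, hy.2⟩) (by simpa)
      · have : Tendsto (fun T : ℝ => -δ * T) atTop atBot :=
          tendsto_id.const_mul_atTop_of_neg (neg_lt_zero.2 hδ)
        simpa using (Real.tendsto_exp_atBot.comp this).const_mul C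
    have hE : Tendsto (fun T : ℝ => Complex.exp (w - (T + y * Complex.I))) atTop (𝓝 0) := by
      rw [tendsto_zero_iff_norm_tendsto_zero]
      simp only [Complex.norm_exp]
      refine Real.tendsto_exp_atBot.comp ?_
      simp only [Complex.sub_re, Complex.add_re, Complex.ofReal_re, Complex.mul_I_re,
        Complex.ofReal_im, neg_zero, add_zero]
      exact tendsto_atBot_add_const_left _ _ tendsto_neg_atTop_atBot
    have := (hΦ0.sub_const (Φ w)).div (hE.const_sub 1) (by simp)
    simp only [zero_sub, sub_zero, div_one] at this
    refine this.congr' ?_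
    filter_upwards [hne] with T hT
    rw [Pi.div_apply, expKernel_of_ne (hT y), hform]

/-- On the left both Φ(z) e^z and e^z tend to 0, while the denominator tends to -e^w. -/
lemma tendsto_integral_expKernel_left
    (hΦ : ∀ z : ℂ, |z.im| ≤ Real.pi → DifferentiableAt ℂ Φ z) (hw : |w.im| < Real.pi) (hδ : 0 < δ)
    (hl : ∀ z : ℂ, |z.im| ≤ Real.pi → z.re ≤ 0 → ‖Φ z * Complex.exp z‖ ≤ C * Real.exp (δ * z.re)) :
    Tendsto (fun T : ℝ => ∫ y in (-Real.pi)..Real.pi, expKernel Φ w ((-T : ℝ) + y * Complex.I)) atTop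
      (𝓝 0) := by
  have hC : 0 ≤ C := by
    have := (norm_nonneg _).trans (hl 0 (by simp [Real.pi_pos.le]) le_rfl)
    simpa using this
  have hne : ∀ᶠ T : ℝ in atTop, ∀ y : ℝ, ((-T : ℝ) + y * Complex.I : ℂ) ≠ w := by
    filter_upwards [eventually_gt_atTop (-w.re)] with T hT y h
    rw [← h] at hT; simp at hT
  have hw0 : 0 < ‖Complex.exp w‖ := norm_pos_iff.2 (Complex.exp_ne_zero w)
  have hlim : ∫ _ in (-Real.pi)..Real.pi, (0 : ℂ) = 0 := by simp
  rw [← hlim]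
  refine intervalIntegral.tendsto_integral_filter_of_dominated_convergence
    (fun _ => (C + ‖Φ w‖) / (‖Complex.exp w‖ / 2))
    (Eventually.of_forall fun T => aestronglyMeasurable_expKernel_vertical hΦ hw (-T)) ?_
    (by simp) ?_
  · filter_upwards [hne, eventually_ge_atTop (1 - w.re), eventually_ge_atTop 0] with T hT hT1 hT0
    refine ae_of_all _ fun y hy => ?_
    rw [uIoc_of_le (by linarith [Real.pi_pos])] at hy
    have hre : ((-T : ℝ) + y * Complex.I : ℂ).re = -T := by simp
    rw [expKernel_of_ne (hT y), norm_div, sub_mul]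
    have h1 : ‖Φ ((-T : ℝ) + y * Complex.I) * Complex.exp ((-T : ℝ) + y * Complex.I)‖ ≤ C := by
      refine (hl _ (by simpa using abs_le.2 ⟨hy.1.le, hy.2⟩) (by rw [hre]; linarith)).trans ?_
      rw [hre]
      have : Real.exp (δ * -T) ≤ 1 := Real.exp_le_one_iff.2 (by nlinarith)
      simpa using mul_le_mul_of_nonneg_left this hC
    have h0 : ‖Complex.exp ((-T : ℝ) + y * Complex.I)‖ = Real.exp (-T) := by
      rw [Complex.norm_exp, hre]
    have h2 : ‖Complex.exp w‖ / 2 ≤ ‖Complex.exp ((-T : ℝ) + y * Complex.I) - Complex.exp w‖ := by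
      have := norm_sub_norm_le (Complex.exp w) (Complex.exp ((-T : ℝ) + y * Complex.I))
      rw [h0, norm_sub_rev] at this
      have h3 : Real.exp (-T) ≤ ‖Complex.exp w‖ * Real.exp (-1) := by
        rw [Complex.norm_exp, ← Real.exp_add]
        exact Real.exp_le_exp.2 (by linarith)
      have h4 := Real.exp_neg_one_lt_half
      nlinarith
    have h5 : ‖Φ w * Complex.exp ((-T : ℝ) + y * Complex.I)‖ ≤ ‖Φ w‖ := by
      rw [norm_mul, h0]
      exact mul_le_of_le_one_right (norm_nonneg _) (Real.exp_le_one_iff.2 (by linarith))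
    gcongr
    exact (norm_sub_le _ _).trans (by gcongr)
  · refine ae_of_all _ fun y hy => ?_
    rw [uIoc_of_le (by linarith [Real.pi_pos])] at hy
    have hE : Tendsto (fun T : ℝ => Complex.exp ((-T : ℝ) + y * Complex.I)) atTop (𝓝 0) := by
      rw [tendsto_zero_iff_norm_tendsto_zero]
      simp only [Complex.norm_exp]
      simpa using Real.tendsto_exp_atBot
    have hΦ0 : Tendsto (fun T : ℝ => Φ ((-T : ℝ) + y * Complex.I) *
        Complex.exp ((-T : ℝ) + y * Complex.I)) atTop (𝓝 0) := by
      refine squeeze_zero_norm' (a := fun T => C * Real.exp (-δ * T)) ?_ ?_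
      · filter_upwards [eventually_ge_atTop 0] with T hT
        have := hl ((-T : ℝ) + y * Complex.I) (by simpa using abs_le.2 ⟨hy.1.le, hy.2⟩) (by simpa)
        simpa using this
      · have : Tendsto (fun T : ℝ => -δ * T) atTop atBot :=
          tendsto_id.const_mul_atTop_of_neg (neg_lt_zero.2 hδ)
        simpa using (Real.tendsto_exp_atBot.comp this).const_mul C
    have := (hΦ0.sub (hE.const_mul (Φ w))).div (hE.sub_const (Complex.exp w))
      (by simp)
    simp only [mul_zero, sub_zero, zero_div] at this
    refine this.congr' ?_
    filter_upwards [hne] with T hT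
    rw [Pi.div_apply, expKernel_of_ne (hT y), sub_mul]

/-- A function analytic in the strip `|Im z| ≤ π` (that is, on the plane cut along the negative
real axis in the variable `e^z`) is the Cauchy integral of its jump. -/
theorem integral_jumpIntegrand {p : ℂ} (hp : p ∈ Complex.slitPlane)
    (hΦ : ∀ z : ℂ, |z.im| ≤ Real.pi → DifferentiableAt ℂ Φ z) (hδ : 0 < δ)
    (hr : ∀ z : ℂ, |z.im| ≤ Real.pi → 0 ≤ z.re → ‖Φ z‖ ≤ C * Real.exp (-δ * z.re))
    (hl : ∀ z : ℂ, |z.im| ≤ Real.pi → z.re ≤ 0 → ‖Φ z * Complex.exp z‖ ≤ C * Real.exp (δ * z.re)) :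
    ∫ u : ℝ, jumpIntegrand Φ p u = 2 * Real.pi * Complex.I * Φ (Complex.log p) := by
  have hw := abs_im_log_lt_pi hp
  have hint := integrable_jumpIntegrand hp hΦ hδ hr hl
  have h1 := intervalIntegral_tendsto_integral hint tendsto_neg_atTop_atBot tendsto_id
  have h2 := tendsto_integral_expKernel_right hΦ hw hδ hr
  have h3 := tendsto_integral_expKernel_left hΦ hw hδ hl
  -- Let the rectangle widen to the whole strip: the right side contributes -2πi Φ(log p) and the
  -- left side nothing.
  have h4 := (h1.add (h2.const_mul Complex.I)).sub (h3.const_mul Complex.I)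
  have h5 : Tendsto (fun _ : ℝ => (0 : ℂ)) atTop (𝓝 0) := tendsto_const_nhds
  have h6 := tendsto_nhds_unique h4 (h5.congr' ?_)
  · linear_combination h6
  · refine Eventually.of_forall fun T => ?_
    have := expKernel_rectangle hΦ hw T
    simp_rw [expKernel_sub_expKernel hp] at this
    exact this.symm

end JumpIntegral

/-! ### The spectral density of the relaxation modulus. -/

section SpectralDensity

variable {K β : ℝ}

/-- The Laplace transform of the relaxation modulus in the variable `z = log p`. -/
noncomputable def relaxPhi (K β : ℝ) (z : ℂ) : ℂ :=
  Complex.exp (-z) * ((1 + (K : ℂ) * Complex.exp (-(β : ℂ) * z)) ^ 2)⁻¹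

lemma one_add_cos_pos (hβ : 0 < β) (hβ1 : β < 1) : 0 < (1 + Real.cos (β * Real.pi)) / 2 := by
  have hpi := Real.pi_pos
  have := Real.cos_lt_cos_of_nonneg_of_le_pi (x := β * Real.pi) (y := Real.pi) (by positivity)
    le_rfl (by nlinarith)
  rw [Real.cos_pi] at this
  linarith

/-- When cos θ = c the difference of the two sides is (1 - c)/2 · (1 - x)². It bounds the
denominator away from zero uniformly on the strip. -/
lemma le_one_add_two_mul_add_sq {c θ x : ℝ} (hx : 0 ≤ x) (hc : c ≤ Real.cos θ) (hc1 : c ≤ 1) :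
    (1 + c) / 2 * (1 + x) ^ 2 ≤ 1 + 2 * x * Real.cos θ + x ^ 2 := by
  nlinarith [mul_nonneg (sub_nonneg.2 hc1) (sq_nonneg (1 - x)), mul_nonneg hx (sub_nonneg.2 hc)]

lemma norm_one_add_mul_exp_sq (K β : ℝ) (z : ℂ) :
    ‖1 + (K : ℂ) * Complex.exp (-(β : ℂ) * z)‖ ^ 2 =
      1 + 2 * (K * Real.exp (-β * z.re)) * Real.cos (β * z.im) + (K * Real.exp (-β * z.re)) ^ 2 := by
  rw [← Complex.normSq_eq_norm_sq, Complex.normSq_apply]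
  simp only [Complex.add_re, Complex.one_re, Complex.re_ofReal_mul, Complex.exp_re,
    Complex.add_im, Complex.one_im, Complex.im_ofReal_mul, Complex.exp_im,
    ← Complex.ofReal_neg, zero_add, neg_mul, Real.cos_neg, Real.sin_neg]
  have := Real.sin_sq_add_cos_sq (β * z.im)
  linear_combination (K * Real.exp (-(β * z.re))) ^ 2 * this

lemma le_norm_one_add_mul_exp_sq (hK : 0 < K) (hβ : 0 < β) (hβ1 : β < 1) {z : ℂ}
    (hz : |z.im| ≤ Real.pi) :
    (1 + Real.cos (β * Real.pi)) / 2 * (1 + K * Real.exp (-β * z.re)) ^ 2 ≤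
      ‖1 + (K : ℂ) * Complex.exp (-(β : ℂ) * z)‖ ^ 2 := by
  have hpi := Real.pi_pos
  rw [norm_one_add_mul_exp_sq]
  refine le_one_add_two_mul_add_sq (by positivity) ?_ (Real.cos_le_one _)
  rw [← Real.cos_abs (β * z.im), abs_mul, abs_of_pos hβ]
  exact Real.cos_le_cos_of_nonneg_of_le_pi (by positivity) (by nlinarith) (by gcongr)

lemma one_add_mul_exp_ne_zero (hK : 0 < K) (hβ : 0 < β) (hβ1 : β < 1) {z : ℂ}
    (hz : |z.im| ≤ Real.pi) : 1 + (K : ℂ) * Complex.exp (-(β : ℂ) * z) ≠ 0 := fun h => by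
  have h1 := le_norm_one_add_mul_exp_sq hK hβ hβ1 hz
  have h2 := one_add_cos_pos hβ hβ1
  rw [h, norm_zero, zero_pow two_ne_zero] at h1
  have : 0 < (1 + Real.cos (β * Real.pi)) / 2 * (1 + K * Real.exp (-β * z.re)) ^ 2 := by positivity
  linarith

lemma differentiableAt_relaxPhi (hK : 0 < K) (hβ : 0 < β) (hβ1 : β < 1) (z : ℂ)
    (hz : |z.im| ≤ Real.pi) : DifferentiableAt ℂ (relaxPhi K β) z := by
  have := one_add_mul_exp_ne_zero hK hβ hβ1 hz
  unfold relaxPhi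
  refine DifferentiableAt.mul (by fun_prop) (DifferentiableAt.inv (by fun_prop) (by positivity))

lemma norm_relaxPhi (K β : ℝ) (z : ℂ) : ‖relaxPhi K β z‖ =
    Real.exp (-z.re) / ‖1 + (K : ℂ) * Complex.exp (-(β : ℂ) * z)‖ ^ 2 := by
  rw [relaxPhi, norm_mul, norm_inv, norm_pow, Complex.norm_exp, Complex.neg_re, div_eq_mul_inv]

lemma norm_relaxPhi_right (hK : 0 < K) (hβ : 0 < β) (hβ1 : β < 1) (z : ℂ)
    (hz : |z.im| ≤ Real.pi) (hre : 0 ≤ z.re) : ‖relaxPhi K β z‖ ≤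
      (1 + (K ^ 2)⁻¹) / ((1 + Real.cos (β * Real.pi)) / 2) * Real.exp (-β * z.re) := by
  have h2 := one_add_cos_pos hβ hβ1
  have h1 : (1 + Real.cos (β * Real.pi)) / 2 ≤ ‖1 + (K : ℂ) * Complex.exp (-(β : ℂ) * z)‖ ^ 2 := by
    refine le_trans ?_ (le_norm_one_add_mul_exp_sq hK hβ hβ1 hz)
    refine le_mul_of_one_le_right h2.le (one_le_pow₀ ?_)
    have : 0 < K * Real.exp (-β * z.re) := by positivity
    linarith
  rw [norm_relaxPhi, div_mul_eq_mul_div]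
  refine div_le_div₀ (by positivity) ?_ h2 h1
  have h3 : Real.exp (-z.re) ≤ Real.exp (-β * z.re) := Real.exp_le_exp.2 (by nlinarith)
  have h4 : 0 < (K ^ 2)⁻¹ * Real.exp (-β * z.re) := by positivity
  linarith

lemma norm_relaxPhi_left (hK : 0 < K) (hβ : 0 < β) (hβ1 : β < 1) (z : ℂ)
    (hz : |z.im| ≤ Real.pi) (hre : z.re ≤ 0) : ‖relaxPhi K β z * Complex.exp z‖ ≤
      (1 + (K ^ 2)⁻¹) / ((1 + Real.cos (β * Real.pi)) / 2) * Real.exp (β * z.re) := by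
  have h2 := one_add_cos_pos hβ hβ1
  set c := (1 + Real.cos (β * Real.pi)) / 2
  have h1 : c * (K * Real.exp (-β * z.re)) ^ 2 ≤
      ‖1 + (K : ℂ) * Complex.exp (-(β : ℂ) * z)‖ ^ 2 := by
    refine le_trans ?_ (le_norm_one_add_mul_exp_sq hK hβ hβ1 hz)
    gcongr
    linarith
  rw [norm_mul, norm_relaxPhi, Complex.norm_exp, div_mul_eq_mul_div, ← Real.exp_add, neg_add_cancel,
    Real.exp_zero]
  -- The true decay is e^(2β Re z); one factor, at most 1, is discarded to match the rate on the
  -- right.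
  have hβz : β * z.re ≤ 0 := mul_nonpos_of_nonneg_of_nonpos hβ.le hre
  calc _ ≤ 1 / (c * (K * Real.exp (-β * z.re)) ^ 2) := by gcongr
    _ = (K ^ 2)⁻¹ / c * (Real.exp (β * z.re) * Real.exp (β * z.re)) := by
      rw [neg_mul, Real.exp_neg]; field_simp
    _ ≤ (1 + (K ^ 2)⁻¹) / c * (Real.exp (β * z.re) * 1) := by
      gcongr
      · linarith
      · exact Real.exp_le_one_iff.2 hβz
    _ = _ := by rw [mul_one]

/-- The spectral density of the relaxation modulus with respect to `u = log r`. -/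
noncomputable def relaxDensity (K β u : ℝ) : ℝ :=
  2 / Real.pi * (K * Real.exp (-β * u)) * Real.sin (β * Real.pi) *
      (1 + K * Real.exp (-β * u) * Real.cos (β * Real.pi)) /
    (1 + 2 * (K * Real.exp (-β * u)) * Real.cos (β * Real.pi) + (K * Real.exp (-β * u)) ^ 2) ^ 2

lemma relaxDensity_denom_pos (hK : 0 < K) (hβ : 0 < β) (hβ1 : β < 1) (u : ℝ) :
    0 < 1 + 2 * (K * Real.exp (-β * u)) * Real.cos (β * Real.pi) + (K * Real.exp (-β * u)) ^ 2 := by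
  have h2 := one_add_cos_pos hβ hβ1
  refine lt_of_lt_of_le ?_ (le_one_add_two_mul_add_sq (by positivity) le_rfl (Real.cos_le_one _))
  positivity

lemma continuous_relaxDensity (hK : 0 < K) (hβ : 0 < β) (hβ1 : β < 1) :
    Continuous (relaxDensity K β) := by
  unfold relaxDensity
  exact Continuous.div (by fun_prop) (by fun_prop) fun u =>
    (pow_pos (relaxDensity_denom_pos hK hβ hβ1 u) 2).ne'

/-- The bound β ≤ 1/2 is what makes cos(βπ) ≥ 0; every other factor is nonnegative for β < 1 anyway.
-/
lemma relaxDensity_nonneg (hK : 0 < K) (hβ : 0 < β) (hβ2 : β ≤ 1 / 2) (u : ℝ) :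
    0 ≤ relaxDensity K β u := by
  have hpi := Real.pi_pos
  have hc : 0 ≤ Real.cos (β * Real.pi) :=
    Real.cos_nonneg_of_neg_pi_div_two_le_of_le (by nlinarith) (by nlinarith)
  have hs : 0 ≤ Real.sin (β * Real.pi) := Real.sin_nonneg_of_nonneg_of_le_pi (by positivity)
    (by nlinarith)
  unfold relaxDensity
  positivity

lemma integrable_relaxDensity (hK : 0 < K) (hβ : 0 < β) (hβ1 : β < 1) :
    Integrable (relaxDensity K β) := by
  have h2 := one_add_cos_pos hβ hβ1
  have hpi := Real.pi_pos
  set c := (1 + Real.cos (β * Real.pi)) / 2 with hc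
  refine ((integrable_exp_neg_mul_abs hβ).const_mul (2 / Real.pi / c ^ 2 * (K + K⁻¹))).mono'
    (continuous_relaxDensity hK hβ hβ1).aestronglyMeasurable (ae_of_all _ fun u => ?_)
  have hD := le_one_add_two_mul_add_sq (x := K * Real.exp (-β * u)) (by positivity) le_rfl
    (Real.cos_le_one (β * Real.pi))
  rw [← hc] at hD
  have hq : 0 < K * Real.exp (-β * u) := by positivity
  -- Writing q for K e^(-βu), the quotient q/(1+q)² is at most q and at most 1/q; use the first for
  -- u ≥ 0 and the second for u ≤ 0.
  have hqq : K * Real.exp (-β * u) / (1 + K * Real.exp (-β * u)) ^ 2 ≤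
      (K + K⁻¹) * Real.exp (-β * |u|) := by
    rcases le_total 0 u with h | h
    · rw [abs_of_nonneg h]
      refine (div_le_self hq.le (one_le_pow₀ (by linarith))).trans ?_
      have : 0 < K⁻¹ * Real.exp (-β * u) := by positivity
      linarith
    · rw [abs_of_nonpos h]
      calc _ ≤ K * Real.exp (-β * u) / (K * Real.exp (-β * u)) ^ 2 := by
            gcongr; linarith
        _ = K⁻¹ * Real.exp (-β * -u) := by
            rw [show -β * -u = -(-β * u) by ring, Real.exp_neg (-β * u)]; field_simp
        _ ≤ _ := by
            gcongr; linarith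
  rw [relaxDensity]
  set q := K * Real.exp (-β * u)
  have hn : ‖2 / Real.pi * q * Real.sin (β * Real.pi) * (1 + q * Real.cos (β * Real.pi))‖ ≤
      2 / Real.pi * q * (1 + q) := by
    rw [norm_mul, norm_mul, Real.norm_of_nonneg (by positivity)]
    have e1 : ‖Real.sin (β * Real.pi)‖ ≤ 1 := Real.abs_sin_le_one _
    have e2 : ‖1 + q * Real.cos (β * Real.pi)‖ ≤ 1 + q := by
      refine (norm_add_le _ _).trans ?_
      rw [norm_one, norm_mul, Real.norm_of_nonneg hq.le]
      gcongr
      exact mul_le_of_le_one_right hq.le (Real.abs_cos_le_one _)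
    calc _ ≤ 2 / Real.pi * q * 1 * (1 + q) := by gcongr
      _ = _ := by ring
  rw [norm_div, Real.norm_of_nonneg (sq_nonneg (1 + 2 * q * Real.cos (β * Real.pi) + q ^ 2))]
  calc _ ≤ 2 / Real.pi * q * (1 + q) / (c * (1 + q) ^ 2) ^ 2 := by gcongr
    _ = 2 / Real.pi / c ^ 2 * (q / (1 + q) ^ 2) / (1 + q) := by field_simp
    _ ≤ 2 / Real.pi / c ^ 2 * (q / (1 + q) ^ 2) := div_le_self (by positivity) (by linarith)
    _ ≤ 2 / Real.pi / c ^ 2 * ((K + K⁻¹) * Real.exp (-β * |u|)) := by gcongr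
    _ = _ := by ring

lemma jumpIntegrand_relaxPhi (hK : 0 < K) (hβ : 0 < β) (hβ1 : β < 1) (p : ℂ) (u : ℝ) :
    jumpIntegrand (relaxPhi K β) p u =
      2 * Real.pi * Complex.I * ((relaxDensity K β u : ℂ) / (Complex.exp u + p)) := by
  have hpi := Real.pi_pos
  have hpi0 : (Real.pi : ℂ) ≠ 0 := by exact_mod_cast hpi.ne'
  set q : ℝ := K * Real.exp (-β * u) with hq
  set c : ℝ := Real.cos (β * Real.pi) with hc
  set s : ℝ := Real.sin (β * Real.pi) with hs
  have hD : (1 + 2 * q * c + q ^ 2 : ℂ) ≠ 0 := by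
    exact_mod_cast (relaxDensity_denom_pos hK hβ hβ1 u).ne'
  have h1 : (K : ℂ) * Complex.exp (-(β : ℂ) * (u + (-Real.pi : ℝ) * Complex.I)) =
      q * (c + s * Complex.I) := by
    rw [show -(β : ℂ) * (u + (-Real.pi : ℝ) * Complex.I) =
      ((-β * u : ℝ) : ℂ) + ((β * Real.pi : ℝ) : ℂ) * Complex.I by push_cast; ring, Complex.exp_add,
      Complex.exp_mul_I, ← Complex.ofReal_cos, ← Complex.ofReal_sin, ← Complex.ofReal_exp, ← hc, ← hs,
      hq]
    push_cast; ring
  have h2 : (K : ℂ) * Complex.exp (-(β : ℂ) * (u + Real.pi * Complex.I)) =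
      q * (c - s * Complex.I) := by
    rw [show -(β : ℂ) * (u + Real.pi * Complex.I) =
      ((-β * u : ℝ) : ℂ) + ((-(β * Real.pi) : ℝ) : ℂ) * Complex.I by push_cast; ring,
      Complex.exp_add, Complex.exp_mul_I, ← Complex.ofReal_cos, ← Complex.ofReal_sin,
      ← Complex.ofReal_exp, Real.cos_neg, Real.sin_neg, ← hc, ← hs, hq]
    push_cast; ring
  have hcs : (s : ℂ) ^ 2 + (c : ℂ) ^ 2 = 1 := by
    exact_mod_cast Real.sin_sq_add_cos_sq (β * Real.pi)
  -- The values of 1 + K e^(-βz) on the two edges are complex conjugates; their product is the real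
  -- denominator of the density.
  have hprod : (1 + q * (c + s * Complex.I)) * (1 + q * (c - s * Complex.I)) =
      (1 + 2 * q * c + q ^ 2 : ℂ) := by
    linear_combination (q : ℂ) ^ 2 * hcs - (q : ℂ) ^ 2 * (s : ℂ) ^ 2 * Complex.I_sq
  have hA : (1 + q * (c + s * Complex.I) : ℂ) ≠ 0 := left_ne_zero_of_mul (hprod ▸ hD)
  have hB : (1 + q * (c - s * Complex.I) : ℂ) ≠ 0 := right_ne_zero_of_mul (hprod ▸ hD)
  have hjump : relaxPhi K β (u + (-Real.pi : ℝ) * Complex.I) - relaxPhi K β (u + Real.pi * Complex.I)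
      = (Complex.exp u)⁻¹ * (4 * Complex.I * q * s * (1 + q * c) / (1 + 2 * q * c + q ^ 2) ^ 2) := by
    rw [relaxPhi, relaxPhi, h1, h2, Complex.exp_neg, Complex.exp_neg, cexp_add_neg_pi_mul_I,
      cexp_add_pi_mul_I, ← hprod]
    have := Complex.exp_ne_zero (u : ℂ)
    field_simp
    ring
  have hw : (relaxDensity K β u : ℂ) =
      2 / Real.pi * q * s * (1 + q * c) / (1 + 2 * q * c + q ^ 2) ^ 2 := by
    rw [relaxDensity, ← hq, ← hc, ← hs]; push_cast; ring
  rw [jumpIntegrand, hjump, hw]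
  have := Complex.exp_ne_zero (u : ℂ)
  field_simp
  ring

lemma relaxPhi_log (K β : ℝ) {p : ℂ} (hp : p ≠ 0) :
    relaxPhi K β (Complex.log p) = p⁻¹ * ((1 + (K : ℂ) * p ^ (-(β : ℂ))) ^ 2)⁻¹ := by
  rw [relaxPhi, Complex.exp_neg, Complex.exp_log hp, Complex.cpow_def_of_ne_zero hp,
    mul_comm (-(β : ℂ))]

lemma integral_relaxDensity_div (hK : 0 < K) (hβ : 0 < β) (hβ1 : β < 1) {p : ℂ}
    (hp : p ∈ Complex.slitPlane) :
    ∫ u : ℝ, (relaxDensity K β u : ℂ) / (Complex.exp u + p) =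
      p⁻¹ * ((1 + (K : ℂ) * p ^ (-(β : ℂ))) ^ 2)⁻¹ := by
  have h := integral_jumpIntegrand hp (differentiableAt_relaxPhi hK hβ hβ1) hβ
    (norm_relaxPhi_right hK hβ hβ1) (norm_relaxPhi_left hK hβ hβ1)
  simp_rw [jumpIntegrand_relaxPhi hK hβ hβ1] at h
  rw [integral_const_mul] at h
  rw [← relaxPhi_log K β (Complex.slitPlane_ne_zero hp)]
  exact mul_left_cancel₀ Complex.two_pi_I_ne_zero h

end SpectralDensity

/-! ### Mixtures of decaying exponentials. -/

section SpectralIntegral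

/-- The superposition of the exponentials `e^{-rt}` with density `w` in the variable `log r`. -/
noncomputable def expMixture (w : ℝ → ℝ) (t : ℝ) : ℝ := ∫ u : ℝ, Real.exp (-Real.exp u * t) * w u

variable {w : ℝ → ℝ}

lemma norm_exp_mul_le {t : ℝ} (ht : 0 ≤ t) (u x : ℝ) : ‖Real.exp (-Real.exp u * t) * x‖ ≤ ‖x‖ := by
  rw [norm_mul, Real.norm_of_nonneg (Real.exp_pos _).le]
  refine mul_le_of_le_one_left (norm_nonneg _) (Real.exp_le_one_iff.2 ?_)
  have := Real.exp_pos u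
  nlinarith

lemma continuousOn_expMixture (hw : Integrable w) : ContinuousOn (expMixture w) (Ioi 0) := by
  refine continuousOn_of_dominated (bound := fun u => ‖w u‖) (fun t _ => ?_)
    (fun t (ht : 0 < t) => ae_of_all _ fun u => norm_exp_mul_le ht.le _ _) hw.norm
    (ae_of_all _ fun u => by fun_prop)
  exact AEStronglyMeasurable.mul (by fun_prop) hw.aestronglyMeasurable

/-- Fubini, with |e^(-rt)| ≤ 1 giving the product bound |e^(-pt)| |w(u)|; the inner integral is
1/(e^u + p). -/
lemma laplace_expMixture (hw : Integrable w) {p : ℂ} (hp : 0 < p.re) :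
    IntegrableOn (fun t : ℝ => Complex.exp (-p * t) * (expMixture w t : ℂ)) (Ioi 0) ∧
      laplace (expMixture w) p = ∫ u : ℝ, (w u : ℂ) / (Complex.exp u + p) := by
  set F : ℝ → ℝ → ℂ := fun t u =>
    Complex.exp (-p * t) * ((Real.exp (-Real.exp u * t) * w u : ℝ) : ℂ) with hF
  have hint : Integrable (Function.uncurry F) ((volume.restrict (Ioi 0)).prod volume) := by
    have h1 : Integrable (fun t : ℝ => Complex.exp (-p * t)) (volume.restrict (Ioi 0)) :=
      integrableOn_exp_mul_complex_Ioi (by simpa) 0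
    refine (h1.mul_prod hw.ofReal).mono ?_ ?_
    · have hw' : AEStronglyMeasurable (fun z : ℝ × ℝ => w z.2)
          ((volume.restrict (Ioi 0)).prod volume) := hw.aestronglyMeasurable.comp_snd
      have : AEStronglyMeasurable (fun z : ℝ × ℝ => Real.exp (-Real.exp z.2 * z.1) * w z.2)
          ((volume.restrict (Ioi 0)).prod volume) :=
        AEStronglyMeasurable.mul (by fun_prop) hw'
      exact AEStronglyMeasurable.mul (by fun_prop)
        (Complex.continuous_ofReal.comp_aestronglyMeasurable this)
    · have hae : ∀ᵐ z : ℝ × ℝ ∂((volume.restrict (Ioi 0)).prod volume), 0 < z.1 := by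
        have : ∀ᵐ t ∂(volume.restrict (Ioi (0 : ℝ))), 0 < t := ae_restrict_mem measurableSet_Ioi
        exact Measure.quasiMeasurePreserving_fst.ae this
      filter_upwards [hae] with z hz
      simp only [Function.uncurry, hF]
      rw [norm_mul, norm_mul, Complex.norm_real]
      gcongr
      simpa using norm_exp_mul_le hz.le z.2 (w z.2)
  have hinner : ∀ t : ℝ, ∫ u, F t u = Complex.exp (-p * t) * (expMixture w t : ℂ) := fun t => by
    simp only [hF]
    rw [integral_const_mul, integral_complex_ofReal, expMixture]
  refine ⟨?_, ?_⟩
  · exact hint.integral_prod_left.congr (ae_of_all _ fun t => hinner t)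
  · rw [laplace]
    simp_rw [← hinner]
    rw [integral_integral_swap hint]
    refine integral_congr_ae (ae_of_all _ fun u => ?_)
    have hre : (-(Complex.exp u + p)).re < 0 := by
      have := Real.exp_pos u
      rw [Complex.neg_re, Complex.add_re, Complex.exp_ofReal_re]
      linarith
    have h := integral_exp_mul_complex_Ioi hre 0
    have e : ∀ t : ℝ, F t u = (w u : ℂ) * Complex.exp (-(Complex.exp u + p) * t) := fun t => by
      simp only [hF]
      push_cast
      rw [← mul_assoc, ← Complex.exp_add, mul_comm]
      congr 2; ring
    simp_rw [e]
    rw [integral_const_mul, h]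
    simp only [Complex.ofReal_zero, mul_zero, Complex.exp_zero]
    rw [neg_div_neg_eq]
    ring

open ProbabilityTheory in
-- The n-th derivative at t is ∫ X^n e^(tX), and X ≤ 0 gives X^n the sign (-1)^n. Finiteness of the
-- measure puts every t > 0 inside the domain of analyticity.
lemma completelyMonotone_mgf {Ω : Type*} [MeasurableSpace Ω] {μ : Measure Ω} [IsFiniteMeasure μ]
    {X : Ω → ℝ} (hX : Measurable X) (hX0 : ∀ x, X x ≤ 0) : CompletelyMonotone (mgf X μ) := by
  have hsub : Ioi 0 ⊆ interior (integrableExpSet X μ) := by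
    refine isOpen_Ioi.subset_interior_iff.2 fun t (ht : 0 < t) => ?_
    refine (integrable_const (1 : ℝ)).mono' (by fun_prop) (ae_of_all _ fun x => ?_)
    rw [Real.norm_of_nonneg (Real.exp_pos _).le]
    exact Real.exp_le_one_iff.2 (mul_nonpos_of_nonneg_of_nonpos ht.le (hX0 x))
  refine ⟨?_, fun n t ht => ?_⟩
  · exact ((analyticOnNhd_mgf.mono hsub).contDiffOn isOpen_Ioi.uniqueDiffOn)
  · rw [iteratedDeriv_mgf (hsub ht), ← integral_const_mul]
    refine integral_nonneg fun x => ?_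
    have : 0 ≤ -X x := by linarith [hX0 x]
    calc (0 : ℝ) ≤ (-X x) ^ n * Real.exp (t * X x) := by positivity
      _ = _ := by rw [neg_pow]; ring

lemma completelyMonotone_expMixture (hw : Integrable w) (hw0 : ∀ u, 0 ≤ w u)
    (hwm : Measurable w) : CompletelyMonotone (expMixture w) := by
  set μ : Measure ℝ := volume.withDensity fun u => ENNReal.ofReal (w u)
  have : IsFiniteMeasure μ := isFiniteMeasure_withDensity_ofReal hw.2
  have h : expMixture w = ProbabilityTheory.mgf (fun u => -Real.exp u) μ := by
    funext t
    rw [ProbabilityTheory.mgf, integral_withDensity_eq_integral_toReal_smul (by fun_prop)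
      (ae_of_all _ fun u => ENNReal.ofReal_lt_top), expMixture]
    refine integral_congr_ae (ae_of_all _ fun u => ?_)
    simp only [ENNReal.toReal_ofReal (hw0 u), smul_eq_mul]
    ring_nf
  rw [h]
  exact completelyMonotone_mgf (by fun_prop) fun u => by simpa using (Real.exp_pos u).le

end SpectralIntegral

/-! ### Admissibility of the power law for exponents between 0 and 1. -/

section Admissible

lemma jumpIntegrand_exp (s : ℝ) (p : ℂ) (u : ℝ) :
    jumpIntegrand (fun z => Complex.exp (-(s : ℂ) * z)) p u =
      2 * Complex.I * (((Real.sin (s * Real.pi) * Real.exp ((1 - s) * u) : ℝ) : ℂ) *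
        (1 / (p + Complex.exp u))) := by
  have h1 : Complex.exp (-(s : ℂ) * (u + (-Real.pi : ℝ) * Complex.I)) =
      Complex.exp (-(s : ℂ) * u) * (Real.cos (s * Real.pi) + Real.sin (s * Real.pi) * Complex.I) := by
    rw [show -(s : ℂ) * (u + (-Real.pi : ℝ) * Complex.I) =
      -(s : ℂ) * u + ((s * Real.pi : ℝ) : ℂ) * Complex.I by push_cast; ring, Complex.exp_add,
      Complex.exp_mul_I, ← Complex.ofReal_cos, ← Complex.ofReal_sin]
  have h2 : Complex.exp (-(s : ℂ) * (u + Real.pi * Complex.I)) =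
      Complex.exp (-(s : ℂ) * u) * (Real.cos (s * Real.pi) - Real.sin (s * Real.pi) * Complex.I) := by
    rw [show -(s : ℂ) * (u + Real.pi * Complex.I) =
      -(s : ℂ) * u + ((-(s * Real.pi) : ℝ) : ℂ) * Complex.I by push_cast; ring, Complex.exp_add,
      Complex.exp_mul_I, ← Complex.ofReal_cos, ← Complex.ofReal_sin, Real.cos_neg, Real.sin_neg]
    push_cast; ring
  have h3 : ((Real.exp ((1 - s) * u) : ℝ) : ℂ) = Complex.exp (-(s : ℂ) * u) * Complex.exp u := by
    rw [← Complex.exp_add]; push_cast; congr 1; ring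
  rw [jumpIntegrand, h1, h2, Complex.ofReal_mul, h3, add_comm p]
  ring

lemma norm_cexp_neg_ofReal_mul (s : ℝ) (z : ℂ) :
    ‖Complex.exp (-(s : ℂ) * z)‖ = Real.exp (-s * z.re) := by
  rw [Complex.norm_exp]; simp

/-- The Cauchy formula for Φ(z) = e^(-sz), that is p^(-s). Decay on the right has rate s and on the
left 1 - s, hence the minimum. -/
lemma integral_exp_mul_div {s : ℝ} (hs0 : 0 < s) (hs1 : s < 1) {p : ℂ}
    (hp : p ∈ Complex.slitPlane) :
    Integrable (fun u : ℝ => ((Real.sin (s * Real.pi) * Real.exp ((1 - s) * u) : ℝ) : ℂ) *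
        (1 / (p + Complex.exp u))) ∧
    ∫ u : ℝ, ((Real.sin (s * Real.pi) * Real.exp ((1 - s) * u) : ℝ) : ℂ) *
        (1 / (p + Complex.exp u)) = Real.pi * p ^ (-(s : ℂ)) := by
  have hd : ∀ z : ℂ, |z.im| ≤ Real.pi →
      DifferentiableAt ℂ (fun z => Complex.exp (-(s : ℂ) * z)) z := fun z _ => by fun_prop
  have hδ : 0 < min s (1 - s) := lt_min hs0 (by linarith)
  have hr : ∀ z : ℂ, |z.im| ≤ Real.pi → 0 ≤ z.re →
      ‖Complex.exp (-(s : ℂ) * z)‖ ≤ 1 * Real.exp (-(min s (1 - s)) * z.re) := fun z _ hz => by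
    rw [norm_cexp_neg_ofReal_mul, one_mul]
    gcongr
    exact min_le_left _ _
  have hl : ∀ z : ℂ, |z.im| ≤ Real.pi → z.re ≤ 0 →
      ‖Complex.exp (-(s : ℂ) * z) * Complex.exp z‖ ≤ 1 * Real.exp (min s (1 - s) * z.re) :=
    fun z _ hz => by
      rw [norm_mul, norm_cexp_neg_ofReal_mul, Complex.norm_exp, ← Real.exp_add, one_mul]
      refine Real.exp_le_exp.2 ?_
      have := min_le_right s (1 - s)
      nlinarith
  have h2 : (2 * Complex.I : ℂ) ≠ 0 := by simp
  have h := integral_jumpIntegrand hp hd hδ hr hl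
  have hi := integrable_jumpIntegrand hp hd hδ hr hl
  have e : jumpIntegrand (fun z => Complex.exp (-(s : ℂ) * z)) p = fun u => _ :=
    funext fun u => jumpIntegrand_exp s p u
  rw [e] at h hi
  rw [integral_const_mul] at h
  refine ⟨(hi.const_mul (2 * Complex.I)⁻¹).congr (ae_of_all _ fun u => ?_), ?_⟩
  · simp only []
    rw [inv_mul_cancel_left₀ h2]
  · refine mul_left_cancel₀ h2 (h.trans ?_)
    rw [Complex.cpow_def_of_ne_zero (Complex.slitPlane_ne_zero hp), mul_comm (-(s : ℂ))]
    ring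

theorem isAdmissible_attenuation {a α : ℝ} (ha : 0 < a) (hα : 0 < α) (hα1 : α < 1) :
    IsAdmissible (attenuation a α) := by
  have hpi := Real.pi_pos
  set s := 1 - α with hs
  have hs0 : 0 < s := by linarith
  have hs1 : s < 1 := by linarith
  have hsin : 0 < Real.sin (s * Real.pi) := Real.sin_pos_of_pos_of_lt_pi (by positivity)
    (by nlinarith)
  -- With r = e^u this is the measure (a/π) sin(απ) r^(α-1) dr, since s = 1 - α.
  set d : ℝ → ℝ := fun u => a / Real.pi * (Real.sin (s * Real.pi) * Real.exp ((1 - s) * u)) with hd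
  have hd0 : ∀ u, 0 ≤ d u := fun u => by positivity
  have hdm : Measurable d := by fun_prop
  set μ : Measure ℝ := volume.withDensity fun u => ENNReal.ofReal (d u) with hμ
  have hres : (μ.map Real.exp).restrict (Ioi 0) = μ.map Real.exp := by
    rw [Measure.restrict_map Real.measurable_exp measurableSet_Ioi]
    congr 1
    rw [show Real.exp ⁻¹' Ioi 0 = univ from eq_univ_of_forall fun u => Real.exp_pos u,
      Measure.restrict_univ]
  refine ⟨μ.map Real.exp, ?_, fun p hp => ?_⟩
  · rw [hres, lintegral_map (by fun_prop) Real.measurable_exp,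
      lintegral_withDensity_eq_lintegral_mul _ (by fun_prop) (by fun_prop)]
    have h1 := (integral_exp_mul_div hs0 hs1 (p := 1) (by simp)).1.norm.const_mul (a / Real.pi)
    refine lt_of_le_of_lt (lintegral_mono fun u => ?_) h1.lintegral_lt_top
    simp only [Pi.mul_apply]
    rw [← ENNReal.ofReal_mul (hd0 u)]
    refine ENNReal.ofReal_le_ofReal (le_of_eq ?_)
    rw [norm_mul, Complex.norm_real, Real.norm_of_nonneg (by positivity), hd]
    have : ‖(1 : ℂ) / (1 + Complex.exp u)‖ = 1 / (1 + Real.exp u) := by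
      have h : (1 : ℂ) / (1 + Complex.exp u) = ((1 / (1 + Real.exp u) : ℝ) : ℂ) := by push_cast; rfl
      rw [h, Complex.norm_real, Real.norm_of_nonneg (by positivity)]
    rw [this]
    ring
  · have h1 := (integral_exp_mul_div hs0 hs1 hp).2
    have hp0 := Complex.slitPlane_ne_zero hp
    rw [hres, integral_map Real.measurable_exp.aemeasurable
        (Measurable.aestronglyMeasurable (by fun_prop)),
      integral_withDensity_eq_integral_toReal_smul (by fun_prop)
        (ae_of_all _ fun u => ENNReal.ofReal_lt_top)]
    have e : ∀ u : ℝ, (ENNReal.ofReal (d u)).toReal • (1 / (p + (Real.exp u : ℂ))) =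
        ((a / Real.pi : ℝ) : ℂ) * (((Real.sin (s * Real.pi) * Real.exp ((1 - s) * u) : ℝ) : ℂ) *
        (1 / (p + Complex.exp u))) := fun u => by
      rw [ENNReal.toReal_ofReal (hd0 u), Complex.real_smul, hd, Complex.ofReal_mul (a / Real.pi),
        Complex.ofReal_exp u, mul_assoc]
    simp_rw [e]
    rw [integral_const_mul, h1, attenuation]
    have hpi0 : (Real.pi : ℂ) ≠ 0 := by exact_mod_cast hpi.ne'
    have h2 : p * p ^ (-(s : ℂ)) = p ^ (α : ℂ) := by
      nth_rewrite 1 [← Complex.cpow_one p]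
      rw [← Complex.cpow_add _ _ hp0]
      congr 1
      rw [hs]; push_cast; ring
    rw [← h2]
    push_cast
    field_simp

end Admissible

/-! ### Complete monotonicity of powers and the Bernstein property of the ordinary function f. -/

section BernsteinFunctions

lemma CompletelyMonotone.congr {f g : ℝ → ℝ} (hf : CompletelyMonotone f)
    (h : EqOn f g (Ioi 0)) : CompletelyMonotone g := by
  refine ⟨hf.1.congr fun t ht => (h ht).symm, fun n t ht => ?_⟩
  rw [← h.iteratedDeriv_of_isOpen isOpen_Ioi n ht]
  exact hf.2 n t ht

lemma eqOn_deriv {f g : ℝ → ℝ} (h : EqOn f g (Ioi 0)) : EqOn (deriv f) (deriv g) (Ioi 0) :=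
  fun _ ht => (h.eventuallyEq_of_mem (Ioi_mem_nhds ht)).deriv_eq

lemma IsBernstein.congr {f g : ℝ → ℝ} (hf : IsBernstein f) (h : EqOn f g (Ioi 0)) :
    IsBernstein g :=
  ⟨hf.1.congr fun _ ht => (h ht).symm, fun t ht => h ht ▸ hf.2.1 t ht,
    hf.2.2.congr (eqOn_deriv h)⟩

lemma IsBernstein.monotoneOn {g : ℝ → ℝ} (hg : IsBernstein g) : MonotoneOn g (Ioi 0) := by
  refine monotoneOn_of_deriv_nonneg (convex_Ioi 0) hg.1.continuousOn ?_ fun t ht => ?_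
  · rw [interior_Ioi]; exact hg.1
  · rw [interior_Ioi] at ht
    simpa using hg.2.2.2 0 t ht

lemma CompletelyMonotone.antitoneOn {g : ℝ → ℝ} (hg : CompletelyMonotone g) :
    AntitoneOn g (Ioi 0) := by
  refine antitoneOn_of_deriv_nonpos (convex_Ioi 0) hg.1.continuousOn ?_ fun t ht => ?_
  · rw [interior_Ioi]; exact hg.1.differentiableOn (by simp)
  · rw [interior_Ioi] at ht
    have := hg.2 1 t ht
    rw [iteratedDeriv_one] at this
    linarith

lemma iteratedDeriv_two_powers (A B r s : ℝ) (n : ℕ) {t : ℝ} (ht : 0 < t) :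
    iteratedDeriv n (fun t => A * t ^ r + B * t ^ s) t =
      A * ((descPochhammer ℝ n).eval r * t ^ (r - n)) +
        B * ((descPochhammer ℝ n).eval s * t ^ (s - n)) := by
  have hc : ∀ q : ℝ, ContDiffAt ℝ n (fun t : ℝ => t ^ q) t := fun q =>
    Real.contDiffAt_rpow_const_of_ne ht.ne'
  have h := iteratedDeriv_add (contDiffAt_const (c := A) |>.mul (hc r))
    (contDiffAt_const (c := B) |>.mul (hc s))
  have h' : (fun t => A * t ^ r + B * t ^ s) =
    (fun t => A * t ^ r) + fun t => B * t ^ s := rfl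
  rw [h', h]
  have e : ∀ C q : ℝ, iteratedDeriv n (fun t => C * t ^ q) t =
      C * ((descPochhammer ℝ n).eval q * t ^ (q - n)) := fun C q => by
    have := iteratedDeriv_const_mul C (hc q)
    rw [iteratedDeriv_eq_iterate (f := fun t : ℝ => t ^ q), Real.iter_deriv_rpow_const] at this
    exact this
  rw [e, e]

lemma neg_one_pow_mul_descPochhammer_nonneg {r : ℝ} (hr : r ≤ 0) (n : ℕ) :
    0 ≤ (-1) ^ n * (descPochhammer ℝ n).eval r := by
  induction n with
  | zero => simp
  | succ n ih =>
    rw [descPochhammer_succ_right, Polynomial.eval_mul, Polynomial.eval_sub, Polynomial.eval_X,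
      Polynomial.eval_natCast, pow_succ]
    have : 0 ≤ n - r := by have : (0 : ℝ) ≤ n := n.cast_nonneg
                           linarith
    nlinarith [mul_nonneg ih this]

lemma completelyMonotone_two_powers {A B r s : ℝ} (hA : 0 ≤ A) (hB : 0 ≤ B) (hr : r ≤ 0)
    (hs : s ≤ 0) : CompletelyMonotone (fun t => A * t ^ r + B * t ^ s) := by
  refine ⟨fun t (ht : 0 < t) => ?_, fun n t ht => ?_⟩
  · exact ((contDiffAt_const.mul (Real.contDiffAt_rpow_const_of_ne ht.ne')).add
      (contDiffAt_const.mul (Real.contDiffAt_rpow_const_of_ne ht.ne'))).contDiffWithinAt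
  · rw [iteratedDeriv_two_powers A B r s n ht]
    have h1 := neg_one_pow_mul_descPochhammer_nonneg hr n
    have h2 := neg_one_pow_mul_descPochhammer_nonneg hs n
    calc (0 : ℝ) ≤ A * ((-1) ^ n * (descPochhammer ℝ n).eval r) * t ^ (r - n) +
          B * ((-1) ^ n * (descPochhammer ℝ n).eval s) * t ^ (s - n) := by positivity
      _ = _ := by ring

variable {c₀ a α : ℝ}

lemma hasDerivAt_fFun (c₀ a α : ℝ) {t : ℝ} (ht : 0 < t) : HasDerivAt (fFun c₀ a α)
    (2 * c₀ * a * (1 - α) / Real.Gamma (2 - α) * t ^ (-α) +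
      c₀ ^ 2 * a ^ 2 * (2 * (1 - α)) / Real.Gamma (3 - 2 * α) * t ^ (1 - 2 * α)) t := by
  have h1 := ((Real.hasDerivAt_rpow_const (p := 1 - α) (Or.inl ht.ne')).const_mul
    (2 * c₀ * a)).div_const (Real.Gamma (2 - α))
  have h2 := ((Real.hasDerivAt_rpow_const (p := 2 * (1 - α)) (Or.inl ht.ne')).const_mul
    (c₀ ^ 2 * a ^ 2)).div_const (Real.Gamma (3 - 2 * α))
  refine ((h1.const_add 1).add h2).congr_deriv ?_
  rw [show 1 - α - 1 = -α by ring, show 2 * (1 - α) - 1 = 1 - 2 * α by ring]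
  ring

lemma continuousOn_fFun (c₀ a α : ℝ) : ContinuousOn (fFun c₀ a α) (Ioi 0) :=
  fun _ ht => (hasDerivAt_fFun c₀ a α ht).continuousAt.continuousWithinAt

lemma isBernstein_fFun (hc₀ : 0 < c₀) (ha : 0 < a) (hα1 : α ≤ 1) (hα2 : 1 / 2 ≤ α) :
    IsBernstein (fFun c₀ a α) := by
  have hG1 : 0 < Real.Gamma (2 - α) := Real.Gamma_pos_of_pos (by linarith)
  have hG2 : 0 < Real.Gamma (3 - 2 * α) := Real.Gamma_pos_of_pos (by linarith)
  have h1 : 0 ≤ 1 - α := by linarith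
  refine ⟨fun t ht => (hasDerivAt_fFun c₀ a α ht).differentiableAt.differentiableWithinAt,
    fun t ht => ?_, ?_⟩
  · unfold fFun; positivity
  · refine (completelyMonotone_two_powers
      (A := 2 * c₀ * a * (1 - α) / Real.Gamma (2 - α))
      (B := c₀ ^ 2 * a ^ 2 * (2 * (1 - α)) / Real.Gamma (3 - 2 * α))
      (r := -α) (s := 1 - 2 * α) (by positivity) (by positivity) (by linarith) (by linarith)).congr
      fun t ht => (hasDerivAt_fFun c₀ a α ht).deriv.symm

/-- A Bernstein function is concave. Multiplied by t^(α+1), the condition f'' ≤ 0 bounds t^(1-α)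
uniformly in t, which fails as t → ∞. -/
lemma not_isBernstein_fFun (hc₀ : 0 < c₀) (ha : 0 < a) (hα2 : α < 1 / 2) :
    ¬ IsBernstein (fFun c₀ a α) := fun h => by
  have hG1 : 0 < Real.Gamma (2 - α) := Real.Gamma_pos_of_pos (by linarith)
  have hG2 : 0 < Real.Gamma (3 - 2 * α) := Real.Gamma_pos_of_pos (by linarith)
  have h1 : 0 < 1 - α := by linarith
  set A := 2 * c₀ * a * (1 - α) / Real.Gamma (2 - α) with hA
  set B := c₀ ^ 2 * a ^ 2 * (2 * (1 - α)) / Real.Gamma (3 - 2 * α) with hB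
  have hBpos : 0 < B := by positivity
  have hcm : CompletelyMonotone (fun t => A * t ^ (-α) + B * t ^ (1 - 2 * α)) :=
    h.2.2.congr fun t ht => (hasDerivAt_fFun c₀ a α ht).deriv
  have hineq : ∀ t : ℝ, 0 < t → B * (1 - 2 * α) * t ^ (1 - α) ≤ A * α := fun t ht => by
    have h2 := hcm.2 1 t ht
    rw [iteratedDeriv_two_powers _ _ _ _ _ ht] at h2
    simp only [descPochhammer_one, Polynomial.eval_X, Nat.cast_one, pow_one] at h2
    have h3 : t ^ (-α - 1) * t ^ (α + 1) = 1 := by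
      rw [← Real.rpow_add ht, show -α - 1 + (α + 1) = 0 by ring, Real.rpow_zero]
    have h4 : t ^ (1 - 2 * α - 1) * t ^ (α + 1) = t ^ (1 - α) := by
      rw [← Real.rpow_add ht]; congr 1; ring
    have h5 : 0 < t ^ (α + 1) := by positivity
    have h6 := mul_nonneg h2 h5.le
    have h7 : (-1 * (A * (-α * t ^ (-α - 1)) + B * ((1 - 2 * α) * t ^ (1 - 2 * α - 1)))) *
        t ^ (α + 1) = A * α * (t ^ (-α - 1) * t ^ (α + 1)) -
          B * (1 - 2 * α) * (t ^ (1 - 2 * α - 1) * t ^ (α + 1)) := by ring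
    have h8 : 0 ≤ (-1 * (A * (-α * t ^ (-α - 1)) + B * ((1 - 2 * α) * t ^ (1 - 2 * α - 1)))) *
        t ^ (α + 1) := by linarith
    rw [h7, h3, h4] at h8
    linarith
  have hpos : 0 < B * (1 - 2 * α) := mul_pos hBpos (by linarith)
  have hT := (tendsto_rpow_atTop h1).const_mul_atTop hpos
  obtain ⟨t, ht, ht0⟩ := ((hT.eventually_gt_atTop (A * α)).and (eventually_gt_atTop 0)).exists
  linarith [hineq t ht0]

end BernsteinFunctions

/-! ### The distribution f as an ordinary function when α ≤ 1. -/

section OrdinaryFunction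

lemma homDist_of_nonneg {s : ℝ} (hs : 0 ≤ s) (φ : ℝ → ℂ) : homDist s φ =
    ∫ t in Ioi (0 : ℝ), ((t ^ s / Real.Gamma (s + 1) : ℝ) : ℂ) * φ t := by
  have h : ⌊-s⌋₊ = 0 := Nat.floor_of_nonpos (by linarith)
  unfold homDist
  rw [h]
  simp

lemma integrable_rpow_mul {s : ℝ} (hs : 0 ≤ s) (c : ℝ) {φ : ℝ → ℂ} (hφ : Continuous φ)
    (hc : HasCompactSupport φ) :
    IntegrableOn (fun t : ℝ => ((t ^ s / c : ℝ) : ℂ) * φ t) (Ioi 0) := by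
  refine (Continuous.integrable_of_hasCompactSupport ?_ hc.mul_left).integrableOn
  exact (Complex.continuous_ofReal.comp
    ((Real.continuous_rpow_const hs).div_const c)).mul hφ

lemma fDist_eq_integral_fFun {c₀ a α : ℝ} (hα1 : α ≤ 1) {φ : ℝ → ℂ} (hφ : Continuous φ)
    (hc : HasCompactSupport φ) :
    fDist c₀ a α φ = ∫ t in Ioi (0 : ℝ), (fFun c₀ a α t : ℂ) * φ t := by
  have h0 : (0 : ℝ) ≤ 0 := le_rfl
  have h1 : 0 ≤ 1 - α := by linarith
  have h2 : 0 ≤ 2 * (1 - α) := by linarith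
  have i0 := integrable_rpow_mul h0 (Real.Gamma (0 + 1)) hφ hc
  have i1 := (integrable_rpow_mul h1 (Real.Gamma (1 - α + 1)) hφ hc).const_mul
    (2 * (c₀ : ℂ) * (a : ℂ))
  have i2 := (integrable_rpow_mul h2 (Real.Gamma (2 * (1 - α) + 1)) hφ hc).const_mul
    ((c₀ : ℂ) ^ 2 * (a : ℂ) ^ 2)
  rw [fDist, homDist_of_nonneg h0, homDist_of_nonneg h1, homDist_of_nonneg h2,
    ← integral_const_mul, ← integral_const_mul, ← integral_add i0 i1]
  refine (integral_add (Integrable.add i0 i1) i2).symm.trans ?_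
  refine integral_congr_ae (ae_of_all _ fun t => ?_)
  simp only [fFun, Real.rpow_zero, Pi.add_apply]
  rw [show 1 - α + 1 = 2 - α by ring, show 2 * (1 - α) + 1 = 3 - 2 * α by ring, zero_add,
    Real.Gamma_one]
  push_cast
  ring

lemma integrable_continuousOn_mul {g : ℝ → ℝ} (hg : ContinuousOn g (Ioi 0)) {k : ℝ → ℝ}
    (hk : Continuous k) (hc : HasCompactSupport k) (hs : tsupport k ⊆ Ioi 0) :
    Integrable fun t => k t • g t := by
  refine (integrableOn_iff_integrable_of_support_subset (s := tsupport k) ?_).1 ?_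
  · intro t ht
    refine subset_tsupport k fun h => ht ?_
    simp [h]
  · exact (hk.continuousOn.smul (hg.mono hs)).integrableOn_compact hc

/-- Continuous functions on `]0,∞[` that agree as distributions are equal. -/
lemma eqOn_of_forall_integral_eq {g h : ℝ → ℝ} (hg : ContinuousOn g (Ioi 0))
    (hh : ContinuousOn h (Ioi 0))
    (H : ∀ φ : ℝ → ℂ, ContDiff ℝ ∞ φ → HasCompactSupport φ →
      ∫ t in Ioi (0 : ℝ), (g t : ℂ) * φ t = ∫ t in Ioi (0 : ℝ), (h t : ℂ) * φ t) :
    EqOn g h (Ioi 0) := by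
  have key : ∀ᵐ t : ℝ, t ∈ Ioi (0 : ℝ) → g t - h t = 0 := by
    refine isOpen_Ioi.ae_eq_zero_of_integral_contDiff_smul_eq_zero
      ((hg.sub hh).locallyIntegrableOn measurableSet_Ioi) fun k hk hc hs => ?_
    have hφ := H (fun t => (k t : ℂ)) (Complex.ofRealCLM.contDiff.comp hk)
      (hc.comp_left (g := fun x : ℝ => (x : ℂ)) Complex.ofReal_zero)
    have e : ∀ f : ℝ → ℝ, ∫ t in Ioi (0 : ℝ), (f t : ℂ) * (k t : ℂ) =
        ((∫ t : ℝ, k t • f t : ℝ) : ℂ) := fun f => by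
      have hz : ∀ t, t ∉ Ioi (0 : ℝ) → k t • f t = 0 := fun t ht => by
        have : k t = 0 := by
          by_contra h0
          exact ht (hs (subset_tsupport k h0))
        simp [this]
      rw [← setIntegral_eq_integral_of_forall_compl_eq_zero hz, ← integral_complex_ofReal]
      refine integral_congr_ae (ae_of_all _ fun t => ?_)
      simp [mul_comm]
    rw [e, e] at hφ
    have hφ := Complex.ofReal_injective hφ
    simp_rw [smul_sub]
    rw [integral_sub (integrable_continuousOn_mul hg hk.continuous hc hs)
      (integrable_continuousOn_mul hh hk.continuous hc hs), hφ, sub_self]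
  refine Measure.eqOn_open_of_ae_eq (μ := volume) ?_ isOpen_Ioi hg hh
  refine (ae_restrict_iff' measurableSet_Ioi).2 ?_
  filter_upwards [key] with t ht hmem
  exact sub_eq_zero.1 (ht hmem)

/-- Any Bernstein function representing the distribution is continuous on ]0,∞[, so it coincides
there with the explicit formula. -/
lemma distIsBernstein_iff_isBernstein_fFun {c₀ a α : ℝ} (hα1 : α ≤ 1) :
    DistIsBernstein (fDist c₀ a α) ↔ IsBernstein (fFun c₀ a α) := by
  refine ⟨fun ⟨g, hg, H⟩ => ?_, fun h => ⟨_, h, fun φ hφ hc =>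
    fDist_eq_integral_fFun hα1 hφ.continuous hc⟩⟩
  refine hg.congr (eqOn_of_forall_integral_eq hg.1.continuousOn (continuousOn_fFun c₀ a α) ?_)
  intro φ hφ hc
  rw [← H φ hφ hc, fDist_eq_integral_fFun hα1 hφ.continuous hc]

end OrdinaryFunction

/-! ### Scaling argument: for α > 1 the distribution f is not a Bernstein function. -/

section Singular

/-- Homogeneity: the factor l^m from the chain rule splits as l^(-s) l^(s+m), and the second part is
absorbed into (lt)^(s+m). -/
lemma homDist_comp_mul {φ : ℝ → ℂ} (hφ : ContDiff ℝ ∞ φ) (s : ℝ) {l : ℝ} (hl : 0 < l) :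
    homDist s (fun t => φ (l * t)) = ((l ^ (-(s + 1)) : ℝ) : ℂ) * homDist s φ := by
  unfold homDist
  set m := ⌊-s⌋₊
  have hit : iteratedDeriv m (fun t => φ (l * t)) = fun t => l ^ m • iteratedDeriv m φ (l * t) :=
    iteratedDeriv_comp_const_smul (hφ.of_le (by exact_mod_cast le_top)) l
  have h := integral_comp_mul_left_Ioi (fun t : ℝ =>
    ((t ^ (s + m) / Real.Gamma (s + m + 1) : ℝ) : ℂ) * iteratedDeriv m φ t) 0 hl
  rw [mul_zero] at h
  have e : ∀ t ∈ Ioi (0 : ℝ), ((t ^ (s + m) / Real.Gamma (s + m + 1) : ℝ) : ℂ) *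
      iteratedDeriv m (fun t => φ (l * t)) t = ((l ^ (-s) : ℝ) : ℂ) *
      ((((l * t) ^ (s + m) / Real.Gamma (s + m + 1) : ℝ) : ℂ) * iteratedDeriv m φ (l * t)) :=
    fun t (ht : 0 < t) => by
      have h1 : l ^ (-s) * l ^ (s + m) = l ^ m := by
        rw [← Real.rpow_add hl, neg_add_cancel_left, Real.rpow_natCast]
      simp only [hit]
      rw [Real.mul_rpow hl.le ht.le, Complex.real_smul, ← h1]
      push_cast
      ring
  rw [setIntegral_congr_fun measurableSet_Ioi e, integral_const_mul, h, Complex.real_smul,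
    neg_add, Real.rpow_add hl, Real.rpow_neg_one]
  push_cast
  ring

/-- Integrating from R keeps the primitive zero to the right of R; nothing is claimed on the left.
-/
lemma exists_iteratedDeriv_eq (m : ℕ) {ψ : ℝ → ℂ} {R : ℝ} (hψ : ContDiff ℝ ∞ ψ)
    (h0 : ∀ t, R ≤ t → ψ t = 0) :
    ∃ Φ : ℝ → ℂ, ContDiff ℝ ∞ Φ ∧ (∀ t, R ≤ t → Φ t = 0) ∧ iteratedDeriv m Φ = ψ := by
  induction m with
  | zero => exact ⟨ψ, hψ, h0, iteratedDeriv_zero⟩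
  | succ m ih =>
    obtain ⟨Φ, hΦ, hΦ0, hΦm⟩ := ih
    have hd : ∀ t, HasDerivAt (fun t => ∫ x in R..t, Φ x) (Φ t) t := fun t =>
      intervalIntegral.integral_hasDerivAt_right (hΦ.continuous.intervalIntegrable _ _)
        (hΦ.continuous.stronglyMeasurableAtFilter _ _) hΦ.continuous.continuousAt
    have hd' : deriv (fun t => ∫ x in R..t, Φ x) = Φ := funext fun t => (hd t).deriv
    refine ⟨fun t => ∫ x in R..t, Φ x, ?_, fun t ht => ?_, ?_⟩
    · rw [contDiff_infty_iff_deriv, hd']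
      exact ⟨fun t => (hd t).differentiableAt, hΦ⟩
    · change ∫ x in R..t, Φ x = 0
      rw [intervalIntegral.integral_congr (g := fun _ => 0), intervalIntegral.integral_zero]
      intro x hx
      rw [uIcc_of_le ht] at hx
      exact hΦ0 x hx.1
    · rw [iteratedDeriv_succ', hd', hΦm]

lemma integral_rpow_mul_bump_pos (x : ℝ) (f : ContDiffBump (1 : ℝ)) (hf : f.rOut < 1) :
    0 < ∫ t in Ioi (0 : ℝ), t ^ x * f t := by
  have hball : Metric.closedBall (1 : ℝ) f.rOut ⊆ Ioi 0 := fun t ht => by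
    rw [Real.closedBall_eq_Icc] at ht
    exact lt_of_lt_of_le (by linarith) ht.1
  have hint : IntegrableOn (fun t => t ^ x * f t) (Ioi 0) := by
    refine IntegrableOn.of_forall_sdiff_eq_zero (s := Metric.closedBall (1 : ℝ) f.rOut) ?_
      measurableSet_Ioi fun t ht => ?_
    · refine ContinuousOn.integrableOn_compact (isCompact_closedBall _ _) (fun t ht => ?_)
      exact ((Real.continuousAt_rpow_const _ _ (Or.inl (hball ht).ne')).mul
        f.continuous.continuousAt).continuousWithinAt
    · rw [f.zero_of_le_dist, mul_zero]
      have := ht.2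
      rw [Metric.mem_closedBall, not_le] at this
      exact this.le
  rw [setIntegral_pos_iff_support_of_nonneg_ae _ hint]
  · refine lt_of_lt_of_le (Metric.measure_ball_pos volume (1 : ℝ) f.rOut_pos)
      (measure_mono fun t ht => ⟨?_, hball (Metric.ball_subset_closedBall ht)⟩)
    have : 0 < t := hball (Metric.ball_subset_closedBall ht)
    exact (mul_pos (by positivity) (f.pos_of_mem_ball ht)).ne'
  · refine (ae_restrict_iff' measurableSet_Ioi).2 (ae_of_all _ fun t (ht : 0 < t) => ?_)
    exact mul_nonneg (by positivity) f.nonneg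

/-- The homogeneous distributions do not vanish. -/
lemma exists_homDist_ne_zero (s : ℝ) : ∃ φ : ℝ → ℂ, ContDiff ℝ ∞ φ ∧ HasCompactSupport φ ∧
    homDist s φ ≠ 0 := by
  set m := ⌊-s⌋₊ with hm
  let f : ContDiffBump (1 : ℝ) := ⟨1 / 4, 1 / 2, by norm_num, by norm_num⟩
  -- The iterated primitive Φ need not have compact support on the left. This cutoff equals 1 on
  -- [-2, 2] and Φ vanishes beyond 2, so on ]0,∞[ nothing changes.
  let χ : ContDiffBump (0 : ℝ) := ⟨2, 3, by norm_num, by norm_num⟩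
  obtain ⟨Φ, hΦ, hΦ0, hΦm⟩ := exists_iteratedDeriv_eq m (ψ := fun t => (f t : ℂ)) (R := 2)
    (Complex.ofRealCLM.contDiff.comp f.contDiff) fun t ht => by
      rw [f.zero_of_le_dist, Complex.ofReal_zero]
      rw [Real.dist_eq, abs_of_nonneg (by linarith)]
      change (1 / 2 : ℝ) ≤ _
      linarith
  have heq : EqOn (fun t => (χ t : ℂ) * Φ t) Φ (Ioi 0) := fun t (ht : 0 < t) => by
    rcases le_total t 2 with h | h
    · have : χ t = 1 := χ.one_of_mem_closedBall (by
        rw [Metric.mem_closedBall, Real.dist_eq, sub_zero, abs_of_pos ht]; exact h)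
      simp [this]
    · simp [hΦ0 t h]
  refine ⟨fun t => (χ t : ℂ) * Φ t, (Complex.ofRealCLM.contDiff.comp χ.contDiff).mul hΦ, ?_, ?_⟩
  · exact (χ.hasCompactSupport.comp_left (g := fun x : ℝ => (x : ℂ))
      Complex.ofReal_zero).mul_right
  · have hx : -1 < s + m := by
      have := Nat.lt_floor_add_one (-s)
      rw [← hm] at this
      linarith
    have hG : 0 < Real.Gamma (s + m + 1) := Real.Gamma_pos_of_pos (by linarith)
    have hI := integral_rpow_mul_bump_pos (s + m) f (by change (1 / 2 : ℝ) < 1; norm_num)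
    have hval : homDist s (fun t => (χ t : ℂ) * Φ t) = (-1) ^ m *
        (((∫ t in Ioi (0 : ℝ), t ^ (s + m) * f t) / Real.Gamma (s + m + 1) : ℝ) : ℂ) := by
      unfold homDist
      rw [← hm, ← integral_div, ← integral_complex_ofReal]
      congr 1
      refine setIntegral_congr_fun measurableSet_Ioi fun t ht => ?_
      rw [heq.iteratedDeriv_of_isOpen isOpen_Ioi m ht, hΦm]
      push_cast
      ring
    rw [hval]
    refine mul_ne_zero (pow_ne_zero _ (by norm_num)) ?_
    exact_mod_cast (div_pos hI hG).ne'

/-- A Bernstein function is nondecreasing, so g ≤ g(R') on the positive part of the shrinking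
supports; the substitution t ↦ lt then cancels the factor l. -/
lemma norm_integral_mul_comp_mul_le {g : ℝ → ℝ} (hg : IsBernstein g) {φ : ℝ → ℂ}
    (hφ : Continuous φ) (hc : HasCompactSupport φ) : ∃ N : ℝ, ∀ l : ℝ, 1 ≤ l →
      ‖(l : ℂ) * ∫ t in Ioi (0 : ℝ), (g t : ℂ) * φ (l * t)‖ ≤ N := by
  obtain ⟨R, hR⟩ := hc.isCompact.isBounded.subset_closedBall 0
  set R' := max R 1 with hR'
  have hR1 : 0 < R' := lt_of_lt_of_le one_pos (le_max_right _ _)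
  refine ⟨∫ t in Ioi (0 : ℝ), g R' * ‖φ t‖, fun l hl => ?_⟩
  have hl0 : 0 < l := by linarith
  have hφl : Integrable (fun t => g R' * ‖φ (l * t)‖) := by
    have : Integrable (fun t => φ (l * t)) :=
      (hφ.integrable_of_hasCompactSupport hc).comp_mul_left' hl0.ne'
    exact this.norm.const_mul _
  have h1 : ‖∫ t in Ioi (0 : ℝ), (g t : ℂ) * φ (l * t)‖ ≤
      ∫ t in Ioi (0 : ℝ), g R' * ‖φ (l * t)‖ := by
    refine norm_integral_le_of_norm_le hφl.integrableOn
      ((ae_restrict_iff' measurableSet_Ioi).2 (ae_of_all _ fun t (ht : 0 < t) => ?_))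
    rw [norm_mul, Complex.norm_real, Real.norm_of_nonneg (hg.2.1 t ht)]
    by_cases h : φ (l * t) = 0
    · simp [h]
    · have hmem := hR (subset_tsupport φ h)
      rw [Metric.mem_closedBall, Real.dist_eq, sub_zero, abs_of_pos (by positivity)] at hmem
      have htR : t ≤ R' := by
        have := le_max_left R 1
        nlinarith
      exact mul_le_mul_of_nonneg_right (hg.monotoneOn ht hR1 htR) (norm_nonneg _)
  have h2 := integral_comp_mul_left_Ioi' (fun t => g R' * ‖φ t‖) 0 hl0
  rw [mul_zero, smul_eq_mul] at h2
  rw [norm_mul, Complex.norm_real, Real.norm_of_nonneg hl0.le, ← h2]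
  gcongr

lemma eq_zero_of_norm_quadratic_le {A₀ A₁ A₂ : ℂ} {N : ℝ}
    (h : ∀ x : ℝ, 1 ≤ x → ‖A₀ + x * A₁ + x ^ 2 * A₂‖ ≤ N) : A₂ = 0 := by
  by_contra h2
  have hA : 0 < ‖A₂‖ := norm_pos_iff.2 h2
  have hN : 0 ≤ N := (norm_nonneg _).trans (h 1 le_rfl)
  set b := N + ‖A₀‖ + ‖A₁‖ with hb
  have hb0 : 0 ≤ b := by positivity
  -- Chosen so that x‖A₂‖ = ‖A₂‖ + b: the quadratic term then exceeds the bound x b on all the rest.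
  set x := 1 + b / ‖A₂‖ with hx
  have hx1 : 1 ≤ x := by
    have : 0 ≤ b / ‖A₂‖ := by positivity
    linarith
  have e : (x : ℂ) ^ 2 * A₂ = (A₀ + x * A₁ + x ^ 2 * A₂) - (A₀ + x * A₁) := by ring
  have h1 : x ^ 2 * ‖A₂‖ ≤ N + (‖A₀‖ + x * ‖A₁‖) := by
    have hn : ‖(x : ℂ)‖ = x := by rw [Complex.norm_real, Real.norm_of_nonneg (by linarith)]
    calc x ^ 2 * ‖A₂‖ = ‖(x : ℂ) ^ 2 * A₂‖ := by rw [norm_mul, norm_pow, hn]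
      _ ≤ _ := by
        rw [e]
        refine (norm_sub_le _ _).trans (add_le_add (h x hx1) ((norm_add_le _ _).trans ?_))
        rw [norm_mul, hn]
  have h3 : x * ‖A₂‖ = ‖A₂‖ + b := by rw [hx]; field_simp
  have h4 : x * (‖A₂‖ + b) ≤ x * b := by
    calc x * (‖A₂‖ + b) = x ^ 2 * ‖A₂‖ := by rw [← h3]; ring
      _ ≤ N + (‖A₀‖ + x * ‖A₁‖) := h1
      _ ≤ x * b := by rw [hb]; nlinarith [norm_nonneg A₀, norm_nonneg A₁]
  nlinarith

lemma not_distIsBernstein_fDist {c₀ a α : ℝ} (hc₀ : 0 < c₀) (ha : 0 < a) (hα : 1 < α) :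
    ¬ DistIsBernstein (fDist c₀ a α) := by
  rintro ⟨g, hg, H⟩
  obtain ⟨φ, hφ, hc, hne⟩ := exists_homDist_ne_zero (2 * (1 - α))
  obtain ⟨N, hN⟩ := norm_integral_mul_comp_mul_le hg hφ.continuous hc
  have h := eq_zero_of_norm_quadratic_le (A₀ := homDist 0 φ)
    (A₁ := 2 * (c₀ : ℂ) * (a : ℂ) * homDist (1 - α) φ)
    (A₂ := (c₀ : ℂ) ^ 2 * (a : ℂ) ^ 2 * homDist (2 * (1 - α)) φ) (N := N) fun x hx => ?_
  · have h1 : (c₀ : ℂ) ≠ 0 := by exact_mod_cast hc₀.ne'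
    have h2 : (a : ℂ) ≠ 0 := by exact_mod_cast ha.ne'
    exact mul_ne_zero (mul_ne_zero (pow_ne_zero 2 h1) (pow_ne_zero 2 h2)) hne h
  · have hx0 : 0 < x := by linarith
    have hβ : 0 < α - 1 := by linarith
    -- With l^(α-1) = x the three homogeneous terms scale as 1, x and x², so boundedness kills the
    -- coefficient of x².
    set l := x ^ (α - 1)⁻¹ with hl
    have hl1 : 1 ≤ l := Real.one_le_rpow hx (by positivity)
    have hl0 : 0 < l := by linarith
    have hlx : l ^ (α - 1) = x := by
      rw [hl, ← Real.rpow_mul hx0.le, inv_mul_cancel₀ hβ.ne', Real.rpow_one]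
    have hcl : HasCompactSupport fun t => φ (l * t) :=
      hc.comp_homeomorph (Homeomorph.mulLeft₀ l hl0.ne')
    have hφl : ContDiff ℝ ∞ fun t => φ (l * t) := hφ.comp (contDiff_const.mul contDiff_id)
    have hb := hN l hl1
    rw [← H _ hφl hcl, fDist, homDist_comp_mul hφ _ hl0, homDist_comp_mul hφ _ hl0,
      homDist_comp_mul hφ _ hl0] at hb
    have e0 : l * l ^ (-((0 : ℝ) + 1)) = 1 := by
      rw [zero_add, Real.rpow_neg_one, mul_inv_cancel₀ hl0.ne']
    have e1 : l * l ^ (-(1 - α + 1)) = x := by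
      rw [← hlx]; nth_rewrite 1 [← Real.rpow_one l]
      rw [← Real.rpow_add hl0]; congr 1; ring
    have e2 : l * l ^ (-(2 * (1 - α) + 1)) = x ^ 2 := by
      rw [← hlx, ← Real.rpow_natCast, ← Real.rpow_mul hl0.le]
      nth_rewrite 1 [← Real.rpow_one l]
      rw [← Real.rpow_add hl0]; congr 1; push_cast; ring
    have c0 : (l : ℂ) * ((l ^ (-((0 : ℝ) + 1)) : ℝ) : ℂ) = 1 := by exact_mod_cast e0
    have c1 : (l : ℂ) * ((l ^ (-(1 - α + 1)) : ℝ) : ℂ) = x := by exact_mod_cast e1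
    have c2 : (l : ℂ) * ((l ^ (-(2 * (1 - α) + 1)) : ℝ) : ℂ) = (x : ℂ) ^ 2 := by exact_mod_cast e2
    rw [show ∀ y z w P Q R S T : ℂ, (l : ℂ) * (y * P + Q * (z * R) + S * (w * T)) =
      ((l : ℂ) * y) * P + ((l : ℂ) * z) * (Q * R) + ((l : ℂ) * w) * (S * T) by intros; ring,
      c0, c1, c2, one_mul] at hb
    exact hb

end Singular

/-! ### Existence of the relaxation modulus and its range of complete monotonicity. -/

section RelaxationModulus

/-- The Laplace transform `p⁻¹ [1 + K p^(α-1)]⁻²` of the relaxation modulus. -/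
noncomputable def relaxTransform (K α : ℝ) (p : ℂ) : ℂ :=
  p⁻¹ * ((1 + (K : ℂ) * p ^ ((α : ℂ) - 1)) ^ 2)⁻¹

variable {K α : ℝ}

lemma lt_norm_cpow {x β : ℝ} (hx : 0 ≤ x) (hβ : 0 < β) {p : ℂ} (hp : x ^ β⁻¹ < p.re) :
    x < ‖p ^ (β : ℂ)‖ := by
  rw [Complex.norm_cpow_real]
  have h1 : x ^ β⁻¹ < ‖p‖ := hp.trans_le (Complex.re_le_norm p)
  calc x = (x ^ β⁻¹) ^ β := by rw [← Real.rpow_mul hx, inv_mul_cancel₀ hβ.ne', Real.rpow_one]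
    _ < ‖p‖ ^ β := Real.rpow_lt_rpow (by positivity) h1 hβ

lemma norm_mul_cpow_neg_lt_one {β : ℝ} (hK : 0 < K) (hβ : 0 < β) {p : ℂ}
    (hp : K ^ β⁻¹ < p.re) : ‖(K : ℂ) * p ^ (-(β : ℂ))‖ < 1 := by
  have h := lt_norm_cpow hK.le hβ hp
  rw [Complex.cpow_neg, norm_mul, norm_inv, Complex.norm_real, Real.norm_of_nonneg hK.le,
    ← div_eq_mul_inv, div_lt_one (hK.trans h)]
  exact h

lemma one_add_ne_zero_of_norm_lt_one {z : ℂ} (hz : ‖z‖ < 1) : 1 + z ≠ 0 := fun h => by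
  rw [← neg_eq_iff_add_eq_zero.2 h, norm_neg, norm_one] at hz
  exact lt_irrefl _ hz

/-- The denominator of the transform does not vanish far to the right. -/
lemma exists_forall_one_add_mul_cpow_ne_zero (hK : 0 < K) (α : ℝ) : ∃ σ : ℝ, 0 ≤ σ ∧
    ∀ p : ℂ, σ < p.re → 1 + (K : ℂ) * p ^ ((α : ℂ) - 1) ≠ 0 := by
  rcases lt_trichotomy α 1 with h | rfl | h
  · have hβ : 0 < 1 - α := by linarith
    refine ⟨K ^ (1 - α)⁻¹, by positivity, fun p hp => ?_⟩
    have := one_add_ne_zero_of_norm_lt_one (norm_mul_cpow_neg_lt_one hK hβ hp)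
    rwa [Complex.ofReal_sub, Complex.ofReal_one, neg_sub] at this
  · refine ⟨0, le_rfl, fun p _ => ?_⟩
    rw [Complex.ofReal_one, sub_self, Complex.cpow_zero, mul_one]
    exact_mod_cast (by positivity : 1 + K ≠ 0)
  · have hβ : 0 < α - 1 := by linarith
    refine ⟨K⁻¹ ^ (α - 1)⁻¹, by positivity, fun p hp e => ?_⟩
    have h1 := lt_norm_cpow (inv_pos.2 hK).le hβ hp
    rw [Complex.ofReal_sub, Complex.ofReal_one] at h1
    have h2 : ‖(K : ℂ) * p ^ ((α : ℂ) - 1)‖ = 1 := by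
      rw [← neg_eq_iff_add_eq_zero.2 e, norm_neg, norm_one]
    rw [norm_mul, Complex.norm_real, Real.norm_of_nonneg hK.le] at h2
    have h3 : K * K⁻¹ < K * ‖p ^ ((α : ℂ) - 1)‖ := by gcongr
    rw [mul_inv_cancel₀ hK.ne', h2] at h3
    exact lt_irrefl _ h3

lemma ne_zero_of_re_pos {p : ℂ} (hp : 0 < p.re) : p ≠ 0 := by rintro rfl; simp at hp

/-- The relaxation modulus solves `p G̃(p) B(p)² = p² / c₀²`. -/
lemma mul_relaxTransform_mul_waveB_sq {c₀ a : ℝ} (hc₀ : 0 < c₀) {p : ℂ} (hp : p ≠ 0)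
    (h : 1 + ((c₀ * a : ℝ) : ℂ) * p ^ ((α : ℂ) - 1) ≠ 0) :
    p * relaxTransform (c₀ * a) α p * waveB c₀ a α p ^ 2 = p ^ 2 / (c₀ : ℂ) ^ 2 := by
  have hc : (c₀ : ℂ) ≠ 0 := by exact_mod_cast hc₀.ne'
  have h1 : p ^ (α : ℂ) = p * p ^ ((α : ℂ) - 1) := by
    nth_rewrite 2 [← Complex.cpow_one p]
    rw [← Complex.cpow_add _ _ hp]; congr 1; ring
  have h2 : waveB c₀ a α p = p / c₀ * (1 + ((c₀ * a : ℝ) : ℂ) * p ^ ((α : ℂ) - 1)) := by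
    rw [waveB, attenuation, h1]; push_cast; field_simp
  rw [relaxTransform, h2]
  field_simp

lemma isInverseLaplace_const (c : ℝ) : IsInverseLaplace (fun _ => c) fun p => p⁻¹ * c := by
  refine ⟨0, fun p hp => ?_⟩
  have h1 := integrableOn_cexp_mul_rpow (s := 0) (by norm_num) hp
  have h2 := integral_cexp_mul_rpow (s := 0) (by norm_num) hp
  simp only [Real.rpow_zero, Complex.ofReal_one, mul_one, Complex.ofReal_zero, zero_add,
    Real.Gamma_one, one_mul, Complex.cpow_neg, Complex.cpow_one] at h1 h2
  exact ⟨h1.mul_const _, by rw [laplace, integral_mul_const, h2]⟩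

lemma cpow_neg_natCast_mul_add_one {p : ℂ} (hp : p ≠ 0) (β : ℝ) (n : ℕ) :
    p ^ (-((n * β : ℝ) + 1 : ℂ)) = p⁻¹ * (p ^ (-(β : ℂ))) ^ n := by
  rw [← Complex.cpow_nat_mul, ← Complex.cpow_neg_one, ← Complex.cpow_add _ _ hp]
  congr 1; push_cast; ring

lemma hasSum_add_one_mul_pow {y : ℂ} (hy : ‖y‖ < 1) :
    HasSum (fun n : ℕ => ((n : ℂ) + 1) * y ^ n) ((1 - y) ^ 2)⁻¹ := by
  have := hasSum_choose_mul_geometric_of_norm_lt_one 1 hy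
  simpa using this

/-- The truncated n - 1 vanishes at n = 0 and n = 1, so this is the series of (1 - y)⁻² shifted by
two. -/
lemma hasSum_sub_one_mul_pow {y : ℂ} (hy : ‖y‖ < 1) :
    HasSum (fun n : ℕ => ((n - 1 : ℕ) : ℂ) * y ^ n) (y ^ 2 * ((1 - y) ^ 2)⁻¹) := by
  refine (hasSum_nat_add_iff' 2).1 ?_
  have h := (hasSum_add_one_mul_pow hy).mul_left (y ^ 2)
  simp only [Finset.sum_range_succ, Finset.sum_range_zero]
  simp only [zero_tsub, Nat.cast_zero, zero_mul, Nat.sub_self, add_zero, sub_zero]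
  refine h.congr_fun fun n => ?_
  rw [show n + 2 - 1 = n + 1 by omega]
  push_cast; ring

/-- The relaxation modulus exists, as a continuous function. -/
lemma exists_relaxationModulus (hK : 0 < K) (α : ℝ) : ∃ G : ℝ → ℝ, Continuous G ∧
    IsInverseLaplace G (relaxTransform K α) ∧ (1 < α → G 0 = 0) := by
  rcases lt_trichotomy α 1 with h | rfl | h
  · have hβ : 0 < 1 - α := by linarith
    -- Coefficients of (1 + K y)⁻² with y = p^(α-1), which is small far to the right.
    set c : ℕ → ℝ := fun n => (n + 1) * (-K) ^ n with hc
    have hcb : ∀ n, |c n| ≤ 1 * (2 * K) ^ n := fun n => by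
      have h1 : (n : ℝ) + 1 ≤ 2 ^ n := by exact_mod_cast Nat.lt_two_pow_self
      have h2 : (0 : ℝ) ≤ (n : ℝ) + 1 := by positivity
      rw [hc, abs_mul, abs_pow, abs_neg, abs_of_pos hK, abs_of_nonneg h2, one_mul, mul_pow]
      gcongr
    have h2K : 0 < 2 * K := by positivity
    obtain ⟨σ, hσ, hL⟩ := exists_hasSum_laplace_powerSeriesModulus hβ h2K zero_le_one hcb
    refine ⟨_, continuous_powerSeriesModulus hβ h2K zero_le_one hcb,
      ⟨max σ (K ^ (1 - α)⁻¹), fun p hp => ?_⟩, fun h' => absurd h' h.not_gt⟩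
    have hpσ := (le_max_left _ _).trans_lt hp
    have hp0 := ne_zero_of_re_pos (hσ.trans hpσ)
    refine ⟨(hL p hpσ).1, (hL p hpσ).2.unique ?_⟩
    have hy := norm_mul_cpow_neg_lt_one hK hβ ((le_max_right _ _).trans_lt hp)
    have h := (hasSum_add_one_mul_pow (y := -(K * p ^ (-((1 - α : ℝ) : ℂ)))) (by
      rwa [norm_neg])).mul_left p⁻¹
    rw [sub_neg_eq_add] at h
    have e : relaxTransform K α p = p⁻¹ * ((1 + K * p ^ (-((1 - α : ℝ) : ℂ))) ^ 2)⁻¹ := by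
      rw [relaxTransform, Complex.ofReal_sub, Complex.ofReal_one, neg_sub]
    rw [e]
    refine h.congr_fun fun n => ?_
    rw [cpow_neg_natCast_mul_add_one hp0, hc]
    push_cast
    ring
  · refine ⟨fun _ => ((1 + K) ^ 2)⁻¹, continuous_const, ?_, fun h => absurd h (lt_irrefl _)⟩
    have e : relaxTransform K 1 = fun p => p⁻¹ * ((((1 + K) ^ 2)⁻¹ : ℝ) : ℂ) := by
      funext p
      simp [relaxTransform]
    rw [e]
    exact isInverseLaplace_const _
  · have hβ : 0 < α - 1 := by linarith
    -- Now p^(α-1) is large, so expand in its inverse: (1 + K/y)⁻² = (y/K)² (1 + y/K)⁻² with y =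
    -- p^(1-α). The constant coefficient is 0, whence G(0) = 0.
    set c : ℕ → ℝ := fun n => ((n - 1 : ℕ) : ℝ) * (-K⁻¹) ^ n with hc
    have hcb : ∀ n, |c n| ≤ 1 * (2 * K⁻¹) ^ n := fun n => by
      have h1 : ((n - 1 : ℕ) : ℝ) ≤ 2 ^ n := by
        exact_mod_cast (Nat.sub_le n 1).trans Nat.lt_two_pow_self.le
      have h2 : (0 : ℝ) ≤ ((n - 1 : ℕ) : ℝ) := by positivity
      rw [hc, abs_mul, abs_pow, abs_neg, abs_of_pos (inv_pos.2 hK), abs_of_nonneg h2, one_mul,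
        mul_pow]
      gcongr
    have h2K : 0 < 2 * K⁻¹ := by positivity
    obtain ⟨σ, hσ, hL⟩ := exists_hasSum_laplace_powerSeriesModulus hβ h2K zero_le_one hcb
    refine ⟨_, continuous_powerSeriesModulus hβ h2K zero_le_one hcb,
      ⟨max σ (K⁻¹ ^ (α - 1)⁻¹), fun p hp => ?_⟩, fun _ => ?_⟩
    · have hpσ := (le_max_left _ _).trans_lt hp
      have hp0 := ne_zero_of_re_pos (hσ.trans hpσ)
      refine ⟨(hL p hpσ).1, (hL p hpσ).2.unique ?_⟩
      have hy := norm_mul_cpow_neg_lt_one (inv_pos.2 hK) hβ ((le_max_right _ _).trans_lt hp)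
      have h := (hasSum_sub_one_mul_pow (y := -((K⁻¹ : ℝ) * p ^ (-((α - 1 : ℝ) : ℂ)))) (by
        rwa [norm_neg])).mul_left p⁻¹
      rw [sub_neg_eq_add] at h
      have hne := one_add_ne_zero_of_norm_lt_one hy
      have e : relaxTransform K α p = p⁻¹ * ((-((K⁻¹ : ℝ) * p ^ (-((α - 1 : ℝ) : ℂ)))) ^ 2 *
          ((1 + (K⁻¹ : ℝ) * p ^ (-((α - 1 : ℝ) : ℂ))) ^ 2)⁻¹) := by
        have hK0 : (K : ℂ) ≠ 0 := by exact_mod_cast hK.ne'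
        have hpow : p ^ ((α - 1 : ℝ) : ℂ) ≠ 0 := by simp [Complex.cpow_eq_zero_iff, hp0]
        rw [relaxTransform]
        rw [Complex.cpow_neg] at hne ⊢
        rw [show ((α : ℂ) - 1) = ((α - 1 : ℝ) : ℂ) by push_cast; rfl]
        have hden : (1 : ℂ) + ((K⁻¹ : ℝ) : ℂ) * (p ^ ((α - 1 : ℝ) : ℂ))⁻¹ =
            (1 + K * p ^ ((α - 1 : ℝ) : ℂ)) / (K * p ^ ((α - 1 : ℝ) : ℂ)) := by
          rw [Complex.ofReal_inv, ← mul_inv]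
          field_simp
          ring
        rw [hden] at hne ⊢
        have hne' := (div_ne_zero_iff.1 hne).1
        rw [Complex.ofReal_inv]
        field_simp
      rw [e]
      refine h.congr_fun fun n => ?_
      rw [cpow_neg_natCast_mul_add_one hp0, hc]
      push_cast
      ring
    · rw [powerSeriesModulus_zero hβ]
      simp [hc]

lemma completelyMonotone_const {c : ℝ} (hc : 0 ≤ c) : CompletelyMonotone fun _ => c := by
  refine ⟨contDiffOn_const, fun n t _ => ?_⟩
  rw [iteratedDeriv_const]
  split_ifs with h
  · simpa [h] using hc
  · simp

lemma isInverseLaplace_expMixture_relaxDensity (hK : 0 < K) (hα : 0 < α) (hα1 : α < 1) :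
    ∀ p : ℂ, 0 < p.re →
      IntegrableOn (fun t : ℝ =>
        Complex.exp (-p * t) * (expMixture (relaxDensity K (1 - α)) t : ℂ)) (Ioi 0) ∧
      laplace (expMixture (relaxDensity K (1 - α))) p = relaxTransform K α p := fun p hp => by
  have hβ : 0 < 1 - α := by linarith
  have hβ1 : 1 - α < 1 := by linarith
  have h := laplace_expMixture (integrable_relaxDensity hK hβ hβ1) hp
  refine ⟨h.1, ?_⟩
  rw [h.2, integral_relaxDensity_div hK hβ hβ1 (slitPlane_of_re_pos hp), relaxTransform,
    Complex.ofReal_sub, Complex.ofReal_one, neg_sub]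

/-- A nonnegative function cannot have the transform `p⁻¹ [1 + K p^(α-1)]⁻²` on the right
half-plane if `α < 1/2`. -/
lemma not_nonneg_of_laplace_eq {H : ℝ → ℝ} (hK : 0 < K) (hα2 : α < 1 / 2)
    (hH : ∀ p : ℂ, 0 < p.re →
      IntegrableOn (fun t : ℝ => Complex.exp (-p * t) * (H t : ℂ)) (Ioi 0) ∧
      laplace H p = relaxTransform K α p) : ¬ ∀ t, 0 < t → 0 ≤ H t := fun h0 => by
  have hreal : ∀ (r t : ℝ), Complex.exp (-(r : ℂ) * t) * (H t : ℂ) =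
      ((Real.exp (-r * t) * H t : ℝ) : ℂ) := fun r t => by push_cast; rfl
  have hint : ∀ r : ℝ, 0 < r → IntegrableOn (fun t => Real.exp (-r * t) * H t) (Ioi 0) :=
    fun r hr => by
      have := (hH r (by simpa)).1.re
      simp only [hreal, RCLike.re_to_complex, Complex.ofReal_re] at this
      exact this
  have hval : ∀ r : ℝ, 0 < r → ∫ t in Ioi (0 : ℝ), Real.exp (-r * t) * H t =
      r⁻¹ * ((1 + K * r ^ (α - 1)) ^ 2)⁻¹ := fun r hr => by
    have h := (hH r (by simpa)).2
    rw [laplace] at h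
    simp_rw [hreal] at h
    rw [integral_complex_ofReal, relaxTransform] at h
    have e : (r : ℂ) ^ ((α : ℂ) - 1) = ((r ^ (α - 1) : ℝ) : ℂ) := by
      rw [Complex.ofReal_cpow hr.le]; push_cast; rfl
    rw [e] at h
    exact_mod_cast h
  -- For H ≥ 0 the transform is nonincreasing in r, so its value at 1 bounds from below its values
  -- on ]0, 1].
  have hmono : ∀ r : ℝ, 0 < r → r ≤ 1 → ((1 + K) ^ 2)⁻¹ ≤ (K ^ 2)⁻¹ * r ^ (1 - 2 * α) :=
    fun r hr hr1 => by
      have h1 : ∫ t in Ioi (0 : ℝ), Real.exp (-1 * t) * H t ≤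
          ∫ t in Ioi (0 : ℝ), Real.exp (-r * t) * H t := by
        refine setIntegral_mono_on (hint 1 one_pos) (hint r hr) measurableSet_Ioi
          fun t (ht : 0 < t) => ?_
        have := h0 t ht
        gcongr
      rw [hval 1 one_pos, hval r hr, Real.one_rpow, inv_one, one_mul, mul_one] at h1
      refine h1.trans ?_
      have h2 : 0 < r ^ (α - 1) := by positivity
      calc r⁻¹ * ((1 + K * r ^ (α - 1)) ^ 2)⁻¹ ≤ r⁻¹ * ((K * r ^ (α - 1)) ^ 2)⁻¹ := by
            gcongr; linarith
        _ = (K ^ 2)⁻¹ * (r ^ (-1 : ℝ) * (r ^ (1 - α) * r ^ (1 - α))) := by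
            rw [Real.rpow_neg_one, show 1 - α = -(α - 1) by ring, Real.rpow_neg hr.le]
            field_simp
        _ = _ := by
            rw [← Real.rpow_add hr, ← Real.rpow_add hr]; congr 2; ring
  have hcont : Tendsto (fun r : ℝ => (K ^ 2)⁻¹ * r ^ (1 - 2 * α)) (𝓝[>] 0) (𝓝 0) := by
    have := ((Real.continuous_rpow_const (q := 1 - 2 * α) (by linarith)).tendsto 0).const_mul
      (K ^ 2)⁻¹
    rw [Real.zero_rpow (by linarith), mul_zero] at this
    exact this.mono_left nhdsWithin_le_nhds
  have hpos : 0 < ((1 + K) ^ 2)⁻¹ := by positivity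
  obtain ⟨r, hr, hr0, hr1⟩ := ((hcont.eventually_lt_const hpos).and
    (Ioc_mem_nhdsGT (zero_lt_one' ℝ))).exists
  exact absurd (hmono r hr0 hr1) (not_le.2 hr)

/-- The relaxation modulus is completely monotone exactly for `1/2 ≤ α ≤ 1`. -/
lemma completelyMonotone_relaxationModulus_iff (hK : 0 < K) (hα : 0 < α) {G : ℝ → ℝ}
    (hG : Continuous G) (hL : IsInverseLaplace G (relaxTransform K α)) (hG0 : 1 < α → G 0 = 0) :
    CompletelyMonotone G ↔ 1 / 2 ≤ α ∧ α ≤ 1 := by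
  -- The series controls the transform only far to the right. Identifying `G` with the mixture
  -- extends it to Re p > 0, as needed to let r → 0.
  have hmix : α < 1 → EqOn G (expMixture (relaxDensity K (1 - α))) (Ioi 0) := fun hα1 =>
    hL.eqOn hG.continuousOn (continuousOn_expMixture (integrable_relaxDensity hK (by linarith)
      (by linarith))) ⟨0, isInverseLaplace_expMixture_relaxDensity hK hα hα1⟩
  constructor
  · intro hcm
    refine ⟨?_, ?_⟩ <;> by_contra! h
    · refine not_nonneg_of_laplace_eq hK h
        (isInverseLaplace_expMixture_relaxDensity hK hα (by linarith)) fun t ht => ?_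
      rw [← hmix (by linarith) ht]
      simpa using hcm.2 0 t ht
    -- Case α > 1: `G` is nonincreasing with limit 0 at 0+, so it is at most 0, and it is
    -- nonnegative. Its transform would vanish, but p⁻¹ [1 + K p^(α-1)]⁻² does not.
    · have hzero : ∀ t ∈ Ioi (0 : ℝ), G t = 0 := fun t (ht : 0 < t) => by
        have h1 : 0 ≤ G t := by simpa using hcm.2 0 t ht
        have h2 : Tendsto G (𝓝[>] 0) (𝓝 0) := by
          have := hG.tendsto 0
          rw [hG0 h] at this
          exact this.mono_left nhdsWithin_le_nhds
        refine le_antisymm (ge_of_tendsto h2 ?_) h1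
        filter_upwards [Ioc_mem_nhdsGT ht] with s hs
        exact hcm.antitoneOn hs.1 ht hs.2
      obtain ⟨σ, hσ⟩ := hL
      obtain ⟨σ', hσ', hne⟩ := exists_forall_one_add_mul_cpow_ne_zero hK α
      set r := max σ σ' + 1 with hr
      have hr1 : σ < r := by have := le_max_left σ σ'; linarith
      have hr2 : σ' < r := by have := le_max_right σ σ'; linarith
      have h1 := (hσ r (by simpa)).2
      have h2 : laplace G r = 0 := by
        rw [laplace, setIntegral_congr_fun measurableSet_Ioi (g := fun _ => 0) fun t ht => by
          simp [hzero t ht]]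
        simp
      rw [h2, relaxTransform] at h1
      have hr0 : (r : ℂ) ≠ 0 := by exact_mod_cast (hσ'.trans_lt hr2).ne'
      exact mul_ne_zero (inv_ne_zero hr0)
        (inv_ne_zero (pow_ne_zero 2 (hne r (by simpa)))) h1.symm
  · rintro ⟨h1, h2⟩
    rcases h2.lt_or_eq with h2 | rfl
    · have hβ : 0 < 1 - α := by linarith
      have hβ1 : 1 - α < 1 := by linarith
      exact (completelyMonotone_expMixture (integrable_relaxDensity hK hβ hβ1)
        (relaxDensity_nonneg hK hβ (by linarith))
        (continuous_relaxDensity hK hβ hβ1).measurable).congr (hmix h2).symm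
    · have e : relaxTransform K 1 = fun p => p⁻¹ * ((((1 + K) ^ 2)⁻¹ : ℝ) : ℂ) := by
        funext p
        simp [relaxTransform]
      rw [e] at hL
      exact (completelyMonotone_const (by positivity)).congr
        (hL.eqOn hG.continuousOn continuousOn_const (isInverseLaplace_const _)).symm

end RelaxationModulus

/-- Scaling excludes α > 1; below that the explicit formula decides. -/
lemma distIsBernstein_fDist_iff {c₀ a α : ℝ} (hc₀ : 0 < c₀) (ha : 0 < a) :
    DistIsBernstein (fDist c₀ a α) ↔ 1 / 2 ≤ α ∧ α ≤ 1 := by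
  rcases lt_or_ge 1 α with h | h
  · exact iff_of_false (not_distIsBernstein_fDist hc₀ ha h) fun h' => absurd h'.2 h.not_ge
  · rw [distIsBernstein_iff_isBernstein_fFun h]
    refine ⟨fun hB => ⟨?_, h⟩, fun h' => isBernstein_fFun hc₀ ha h h'.1⟩
    by_contra! h2
    exact not_isBernstein_fFun hc₀ ha h2 hB

end PowerLaw

theorem mainTheorem7 (c₀ a α : ℝ) (hc₀ : 0 < c₀) (ha : 0 < a) (hα : 0 < α) :
    -- the distribution `f` is the inverse Laplace transform of `[1 + c₀ a p^(α-1)]² / p`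
    (∀ p : ℂ, 0 < p.re →
      PowerLaw.fDist c₀ a α (fun t : ℝ => Complex.exp (-p * t)) =
        (1 + (c₀ : ℂ) * (a : ℂ) * p ^ ((α : ℂ) - 1)) ^ 2 / p) ∧
    -- for `α < 1`, `f` is an ordinary function, Bernstein exactly for `1/2 ≤ α`
    (α < 1 →
      (∀ φ : ℝ → ℂ, ContDiff ℝ ∞ φ → HasCompactSupport φ →
        PowerLaw.fDist c₀ a α φ = ∫ t in Ioi (0 : ℝ), (PowerLaw.fFun c₀ a α t : ℂ) * φ t) ∧
      (PowerLaw.IsBernstein (PowerLaw.fFun c₀ a α) ↔ 1 / 2 ≤ α)) ∧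
    -- the relaxation modulus `G` exists, as a continuous function on `]0,∞[`
    ∃ G : ℝ → ℝ,
      ContinuousOn G (Ioi 0) ∧
      PowerLaw.IsInverseLaplace G
        (fun p => p⁻¹ * ((1 + (c₀ : ℂ) * (a : ℂ) * p ^ ((α : ℂ) - 1)) ^ 2)⁻¹) ∧
      -- it is unique
      (∀ G' : ℝ → ℝ, ContinuousOn G' (Ioi 0) →
        PowerLaw.IsInverseLaplace G'
          (fun p => p⁻¹ * ((1 + (c₀ : ℂ) * (a : ℂ) * p ^ ((α : ℂ) - 1)) ^ 2)⁻¹) →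
        EqOn G' G (Ioi 0)) ∧
      -- it is the modulus induced by `B`: `p G̃(p) B(p)² = p² / c₀²`
      (∃ σ : ℝ, ∀ p : ℂ, σ < p.re →
        p * PowerLaw.laplace G p * PowerLaw.waveB c₀ a α p ^ 2 = p ^ 2 / (c₀ : ℂ) ^ 2) ∧
      -- the criterion
      (PowerLaw.CompletelyMonotone G ↔ PowerLaw.DistIsBernstein (PowerLaw.fDist c₀ a α)) ∧
      -- the range of exponents
      (α ≠ 1 → (PowerLaw.CompletelyMonotone G ↔ 1 / 2 ≤ α ∧ α < 1)) ∧
      -- admissible attenuation without complete monotonicity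
      (α < 1 / 2 →
        PowerLaw.IsAdmissible (PowerLaw.attenuation a α) ∧ ¬ PowerLaw.CompletelyMonotone G) := by
  have hK : 0 < c₀ * a := mul_pos hc₀ ha
  have hF : (fun p : ℂ => p⁻¹ * ((1 + (c₀ : ℂ) * (a : ℂ) * p ^ ((α : ℂ) - 1)) ^ 2)⁻¹) =
      PowerLaw.relaxTransform (c₀ * a) α := by
    funext p
    rw [PowerLaw.relaxTransform, Complex.ofReal_mul]
  rw [hF]
  refine ⟨fun p hp => PowerLaw.fDist_exp c₀ a α hp, fun hα1 => ⟨fun φ hφ hc =>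
    PowerLaw.fDist_eq_integral_fFun hα1.le hφ.continuous hc, ?_⟩, ?_⟩
  · rw [← PowerLaw.distIsBernstein_iff_isBernstein_fFun hα1.le,
      PowerLaw.distIsBernstein_fDist_iff hc₀ ha]
    exact and_iff_left hα1.le
  · obtain ⟨G, hG, hL, hG0⟩ := PowerLaw.exists_relaxationModulus hK α
    have hcm := PowerLaw.completelyMonotone_relaxationModulus_iff hK hα hG hL hG0
    refine ⟨G, hG.continuousOn, hL, fun G' hG' hL' => hL'.eqOn hG' hG.continuousOn hL, ?_, ?_, ?_,
      fun hα2 => ⟨PowerLaw.isAdmissible_attenuation ha hα (by linarith), ?_⟩⟩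
    · obtain ⟨σ, hσ⟩ := hL
      obtain ⟨σ', hσ', hne⟩ := PowerLaw.exists_forall_one_add_mul_cpow_ne_zero hK α
      refine ⟨max σ σ', fun p hp => ?_⟩
      have hp' := (le_max_right _ _).trans_lt hp
      rw [(hσ p ((le_max_left _ _).trans_lt hp)).2]
      exact PowerLaw.mul_relaxTransform_mul_waveB_sq hc₀
        (PowerLaw.ne_zero_of_re_pos (hσ'.trans_lt hp')) (hne p hp')
    -- Both properties reduce to the same range of α.
    · rw [hcm, PowerLaw.distIsBernstein_fDist_iff hc₀ ha]
    · intro hα1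
      rw [hcm]
      exact and_congr_right fun _ => hα1.le_iff_lt
    · rw [hcm]
      exact fun h => absurd h.1 (not_le.2 hα2)
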